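/- Theorem. Let $k\ge 1$ and $n_0\ge 0$ be integers, let $\lambda_{(n)_i}>0$ and $0<\alpha_n\le 1$ for $n\ge n_0$, $1\le i\le k$, and put $\lambda_{(n)_0}:=1$. Let $q(n,t)$, $t\ge 0$, be state probabilities of the state-dependent generalized fractional birth process, that is, a solution of $$\frac{\mathrm d^{\alpha_n}}{\mathrm dt^{\alpha_n}}q(n,t)=-\sum_{i=1}^{k}\lambda_{(n)_i}\,q(n,t)+\sum_{i=1}^{\min\{n,k\}}\lambda_{(n-i)_i}\,q(n-i,t),\qquad n\ge n_0,$$ with $q(n_0,0)=1$, $q(n,0)=0$ for $n>n_0$, and $q(n,\cdot)=0$ for $n<n_0$. Here, for absolutely continuous $f$, $\frac{\mathrm d^{\alpha}}{\mathrm dt^{\alpha}}f(t)=\frac1{\Gamma(1-\alpha)}\int_0^t(t-s)^{-\alpha}f'(s)\,\mathrm ds$ if $0<\alpha<1$ and $=f'(t)$ if $\alpha=1$ (Caputo derivative); every $q(n,\cdot)$, $n\ge n_0$, is absolutely continuous on each $[0,T]$, and the equations hold for almost every $t>0$. (No other property of $q$, such as $0\le q\le 1$ or $\sum_n q(n,t)\le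 1$, is assumed.) Notation. $E_{\alpha,1}(x)=\sum_{j\ge0}x^j/\Gamma(j\alpha+1)$. $\mathcal L^{-1}(F(s);t)$, $t\ge0$, is the continuous function $f$ on $[0,\infty)$ with $\int_0^\infty e^{-st}f(t)\,\mathrm dt=F(s)$ (absolutely convergent) for all $s>0$. The sets $\Theta_n^k$ of $n$-tuples are given by $\Theta_1^k=\{(1)\}$ and, for $n\ge 2$, $$\Theta_n^k=\bigcup_{i=1}^{k}\{(x,0,\dots,0)+i\,\bar e_n^{\,n-i+1}:x\in\Theta_{n-i}^k\}\ \ (1\le k\le n-1),$$ $$\Theta_n^k=\bigcup_{i=1}^{n-1}\{(x,0,\dots,0)+i\,\bar e_n^{\,n-i+1}:x\in\Theta_{n-i}^n\}\cup\{n\,\bar e_n^{\,1}\}\ \ (k\ge n),$$ where $\bar e_n^{\,j}$ is the $j$-th unit vector and $x\in\Theta^{\cdot}_{n-i}$ is padded with $i$ zeros. For a tuple $x=(x_1,\dots,x_m)$ let $\Lambda_m=\{0,1,\dots,m\}\setminus\{1\le j\le m-1:x_{j+1}=0\}$, $m^*=|\Lambda_m|$, let $0=(j)_1<(j)_2<\dots<(j)_{m^*}=m$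 be the elements of $\Lambda_m$, and $\mu_l=\sum_{i=1}^k\lambda_{(n_0+(j)_l)_i}$. Finally $\Omega^i_N=\{(y_1,\dots,y_N)\in\mathbb N_0^N:\sum_j y_j=i,\ y_j\ge1\text{ for }2\le j\le N\}$. Then, for all $t\ge0$, $$q(n_0,t)=E_{\alpha_{n_0},1}\Big(-\sum_{i=1}^k\lambda_{(n_0)_i}\,t^{\alpha_{n_0}}\Big),$$ and for every $m\ge1$ and $t\ge 0$, $$q(n_0+m,t)=\sum_{x\in\Theta}\ \prod_{j=0}^{m-1}\lambda_{(n_0+j)_{x_{j+1}}}\ \mathcal L^{-1}\left(\frac{s^{\alpha_{n_0}-1}}{\prod_{l=1}^{m^*}\big(s^{\alpha_{n_0+(j)_l}}+\mu_l\big)};t\right),$$ where $\Theta=\Theta_m^k$ if $1\le k\le m-1$ and $\Theta=\Theta_m^m$ if $k\ge m$. For each $x\in\Theta$ this inverse Laplace transform exists, and $$\mathcal L^{-1}\left(\frac{s^{\alpha_{n_0}-1}}{\prod_{l=1}^{m^*}\big(s^{\alpha_{n_0+(j)_l}}+\mu_l\big)};t\right)=\frac{(-1)^{m^*-1}}{\prod_{l=2}^{m^*}\mu_l}\sum_{i=m^*-1}^{\infty}(-1)^i\sum_{y\in\Omega^i_{m^*}}\frac{t^{\sum_{l=1}^{m^*}y_l\alpha_{n_0+(j)_l}}}{\Gamma\big(1+\sum_{l=1}^{m^*}y_l\alpha_{n_0+(j)_l}\big)}\prod_{l=1}^{m^*}\mu_l^{y_l},$$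 the series over $i$ being convergent for every $t\ge0$. -/

import Mathlib

open MeasureTheory Set

noncomputable section

/-- Caputo derivative of order `0 < a ≤ 1` (based at `0`) of `f` at `t`. -/
def caputoDeriv (a : ℝ) (f : ℝ → ℝ) (t : ℝ) : ℝ :=
  if a = 1 then deriv f t
  else (Real.Gamma (1 - a))⁻¹ * ∫ s in (0 : ℝ)..t, (t - s) ^ (-a) * deriv f s

/-- The Mittag-Leffler function `E_{a,1}`. -/
def mittagLeffler (a x : ℝ) : ℝ :=
  ∑' j : ℕ, x ^ j / Real.Gamma (j * a + 1)

/-- `q n t`, `n ≥ n₀`, `t ≥ 0`, solves the fractional system of the state-dependent generalized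
fractional birth process with jump sizes `1, …, k`, rates `lam n i` (jump of size `i` out of the
state `n`), orders `α n`, and initial state `n₀`. States below `n₀` carry no mass.
The functions are locally absolutely continuous on `[0, ∞)`, so that the derivative in the Caputo
derivative exists almost everywhere and is locally integrable, and the equations hold for almost
every `t > 0`. -/
structure SolvesStateDependentGFBP (k n₀ : ℕ) (lam : ℕ → ℕ → ℝ) (α : ℕ → ℝ) (q : ℕ → ℝ → ℝ) :
    Prop where
  below : ∀ n < n₀, ∀ t : ℝ, 0 ≤ t → q n t = 0
  absCont : ∀ n ≥ n₀, ∀ T : ℝ, 0 < T → AbsolutelyContinuousOnInterval (q n) 0 T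
  equation : ∀ n ≥ n₀, ∀ᵐ t ∂(volume.restrict (Ioi (0 : ℝ))),
    caputoDeriv (α n) (q n) t =
      -(∑ i ∈ Finset.Icc 1 k, lam n i) * q n t
        + ∑ i ∈ Finset.Icc 1 (min n k), lam (n - i) i * q (n - i) t
  initial : ∀ n ≥ n₀, q n 0 = if n = n₀ then 1 else 0

/-- The set `Θ_n^k`. The tuple `(x₁, …, x_n)` is the finitely supported sequence with value `x_j`
at `j` for `1 ≤ j ≤ n` and `0` elsewhere; so appending zeros to a tuple does not change it, and
`i • ē^{n-i+1}` is `Finsupp.single (n - i + 1) i`. (`Θ_0^k` is not used.) -/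
def Theta : ℕ → ℕ → Finset (ℕ →₀ ℕ)
  | 0, _ => ∅
  | 1, _ => {Finsupp.single 1 1}
  | n + 2, k =>
    if k ≤ n + 1 then
      (Finset.range k).biUnion fun r =>
        (Theta (n + 2 - (r + 1)) k).image
          fun x => x + Finsupp.single (n + 2 - (r + 1) + 1) (r + 1)
    else
      ((Finset.range (n + 1)).biUnion fun r =>
        (Theta (n + 2 - (r + 1)) (n + 2)).image
          fun x => x + Finsupp.single (n + 2 - (r + 1) + 1) (r + 1))
        ∪ {Finsupp.single 1 (n + 2)}
  termination_by n _ => n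

/-- `Λ_m = {0, …, m} \ {1 ≤ j ≤ m - 1 : x_{j+1} = 0}`. -/
def Lam (m : ℕ) (x : ℕ →₀ ℕ) : Finset ℕ :=
  Finset.range (m + 1) \ (Finset.Icc 1 (m - 1)).filter fun j => x (j + 1) = 0

/-- `m^* = |Λ_m|`. -/
def mStar (m : ℕ) (x : ℕ →₀ ℕ) : ℕ := (Lam m x).card

/-- `(j)_1 < (j)_2 < … < (j)_{m^*}`, the increasing enumeration of `Λ_m`; the index
`l ∈ {1, …, m^*}` is the element `l - 1` of `Fin (mStar m x)`. -/
def jIdx (m : ℕ) (x : ℕ →₀ ℕ) (l : Fin (mStar m x)) : ℕ := (Lam m x).orderEmbOfFin rfl l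

/-- The rates with the convention `λ_{(n)_0} = 1`. -/
def rate (lam : ℕ → ℕ → ℝ) (n i : ℕ) : ℝ := if i = 0 then 1 else lam n i

/-- `μ_l = ∑_{i=1}^k λ_{(n₀ + (j)_l)_i}`. -/
def muRate (k n₀ : ℕ) (lam : ℕ → ℕ → ℝ) (m : ℕ) (x : ℕ →₀ ℕ) (l : Fin (mStar m x)) : ℝ :=
  ∑ i ∈ Finset.Icc 1 k, lam (n₀ + jIdx m x l) i

/-- `Ω^i_N`: tuples `(y₁, …, y_N)` of natural numbers with sum `i` and `y_j ≥ 1` for `j ≥ 2`. -/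
def Omega (N i : ℕ) : Finset (Fin N → ℕ) :=
  (Finset.piAntidiag Finset.univ i).filter fun y => ∀ l : Fin N, (l : ℕ) ≠ 0 → y l ≠ 0

/-- `f` is an inverse Laplace transform of `F`: `f` is continuous on `[0, ∞)` and its Laplace
integral converges (absolutely) to `F s` for every `s > 0`. -/
def IsInverseLaplace (F f : ℝ → ℝ) : Prop :=
  ContinuousOn f (Ici 0) ∧
    ∀ s : ℝ, 0 < s →
      IntegrableOn (fun t => Real.exp (-(s * t)) * f t) (Ioi 0) ∧
        ∫ t in Ioi (0 : ℝ), Real.exp (-(s * t)) * f t = F s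

open Classical in
/-- The inverse Laplace transform `ℒ⁻¹(F(s); t)`, `t ≥ 0`; the continuous function with Laplace
transform `F` (junk value `0` if there is none). -/
def inverseLaplace (F : ℝ → ℝ) : ℝ → ℝ :=
  if h : ∃ f, IsInverseLaplace F f then h.choose else 0

/-- `s ↦ s^{α_{n₀} - 1} / ∏_{l=1}^{m^*} (s^{α_{n₀ + (j)_l}} + μ_l)`. -/
def pathTransform (k n₀ : ℕ) (lam : ℕ → ℕ → ℝ) (α : ℕ → ℝ) (m : ℕ) (x : ℕ →₀ ℕ) (s : ℝ) : ℝ :=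
  s ^ (α n₀ - 1) / ∏ l, (s ^ α (n₀ + jIdx m x l) + muRate k n₀ lam m x l)

/-- The term with index `i` of the series for the inverse transform of `pathTransform`:
`(-1)^i ∑_{y ∈ Ω^i_{m^*}} t^{∑ y_l α_{n₀ + (j)_l}} / Γ(1 + ∑ y_l α_{n₀ + (j)_l}) * ∏ μ_l^{y_l}`. -/
def pathSeriesTerm (k n₀ : ℕ) (lam : ℕ → ℕ → ℝ) (α : ℕ → ℝ) (m : ℕ) (x : ℕ →₀ ℕ) (t : ℝ)
    (i : ℕ) : ℝ :=
  (-1) ^ i * ∑ y ∈ Omega (mStar m x) i,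
    t ^ (∑ l, (y l : ℝ) * α (n₀ + jIdx m x l))
      / Real.Gamma (1 + ∑ l, (y l : ℝ) * α (n₀ + jIdx m x l))
      * ∏ l, muRate k n₀ lam m x l ^ y l

/-- `(-1)^{m^* - 1} / ∏_{l=2}^{m^*} μ_l`. -/
def pathCoeff (k n₀ : ℕ) (lam : ℕ → ℕ → ℝ) (m : ℕ) (x : ℕ →₀ ℕ) : ℝ :=
  (-1) ^ (mStar m x - 1) /
    ∏ l ∈ Finset.univ.filter (fun l : Fin (mStar m x) => (l : ℕ) ≠ 0), muRate k n₀ lam m x l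

end

/-!
Integrating the `n`-th equation by the Riemann–Liouville integral `I^{α_n}`, which inverts the
Caputo derivative up to the initial value (`fracInt_caputoDeriv`), turns the system into
`q_n = q_n(0) + I^{α_n} (∑ λ q_{n-i} - μ_n q_n)`. This triangular system has only one continuous
solution: the equation `v = -μ I^α v` forces `v = 0`, since `μ I^α` is a contraction in the norm
`sup e^{-σt} |v t|` for large `σ` (`eq_zero_of_relaxation`). No Laplace transform of `q` is taken,
so no growth condition on `q` is needed.

A solution is written down path by path. To a finite set `{0} ∪ S` of states belongs the function
`chainFun S`, given by the multi-index series of the theorem. Lowering the exponent of the last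
state `j` in the series shows that
`chainFun (insert j S) = I^{α_j} (chainFun S - μ_j chainFun (insert j S))` (`chainFun_insert`);
the same recursion bounds the terms by `2^{-i} e^{σt}`, hence convergence. Splitting each path at
its last jump, the weighted sum of the chain functions over all paths to `n` is seen to solve the
integral equations (`pathSum_eq_fracInt`), so that it equals `q_n`.

It remains to see that `chainFun S` has the stated Laplace transform for every `s > 0`, not only for
those large `s` where the series can be transformed termwise. The transform of `u = I^α (g - μ u)`
is `ĝ / (s^α + μ)` as soon as `e^{-st} u` is integrable. That follows from
an energy estimate: for `α ≤ 1` the kernel `t^{α-1}` is a mixture of decaying exponentials, and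
therefore `∫ e^{-ct} w (I^α w) ≥ 0` (`integral_mul_fracInt_nonneg`); with `w = g - μ u` this bounds
the weighted `L²` norm of `u` by `μ⁻¹` times that of `g`. Finally, a continuous function is
determined by its Laplace transform (`eq_zero_of_laplace_eq_zero`), so `inverseLaplace` is the chain
function.
-/

/-! ### The Riemann–Liouville fractional integral -/

/-- The Riemann–Liouville fractional integral of order `a > 0` (based at `0`) of `f` at `t`. -/
noncomputable def fracInt (a : ℝ) (f : ℝ → ℝ) (t : ℝ) : ℝ :=
  (Real.Gamma a)⁻¹ * ∫ s in (0 : ℝ)..t, (t - s) ^ (a - 1) * f s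

theorem intervalIntegrable_sub_rpow {a : ℝ} (ha : 0 < a) (r t c : ℝ) :
    IntervalIntegrable (fun s : ℝ => (c - s) ^ (a - 1)) volume r t := by
  have h := (intervalIntegral.intervalIntegrable_rpow' (a := c - r) (b := c - t)
    (by linarith : -1 < a - 1)).comp_sub_left c
  simpa using h

theorem intervalIntegrable_sub_rpow_mul {a : ℝ} (ha : 0 < a) {f : ℝ → ℝ}
    (hf : ContinuousOn f (Ici 0)) {t : ℝ} (ht : 0 ≤ t) :
    IntervalIntegrable (fun s : ℝ => (t - s) ^ (a - 1) * f s) volume 0 t := by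
  apply (intervalIntegrable_sub_rpow ha 0 t t).mul_continuousOn
  apply hf.mono
  rw [uIcc_of_le ht]
  exact Icc_subset_Ici_self

theorem integral_sub_rpow_mul_rpow {a b t : ℝ} (ha : 0 < a) (hb : 0 < b) (ht : 0 < t) :
    ∫ s in (0 : ℝ)..t, (t - s) ^ (a - 1) * s ^ (b - 1) =
      t ^ (a + b - 1) * (Real.Gamma a * Real.Gamma b / Real.Gamma (a + b)) := by
  have h := Complex.betaIntegral_scaled (b : ℂ) (a : ℂ) ht
  rw [Complex.betaIntegral_eq_Gamma_mul_div _ _ (by simpa using hb) (by simpa using ha)] at h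
  have h2 : ∫ x in (0 : ℝ)..t, (x : ℂ) ^ ((b : ℂ) - 1) * ((t : ℂ) - (x : ℂ)) ^ ((a : ℂ) - 1) =
      ((∫ s in (0 : ℝ)..t, (t - s) ^ (a - 1) * s ^ (b - 1) : ℝ) : ℂ) := by
    rw [← intervalIntegral.integral_ofReal]
    apply intervalIntegral.integral_congr
    intro x hx
    rw [uIcc_of_le ht.le] at hx
    have h1 : 0 ≤ t - x := by linarith [hx.2]
    simp only
    rw [Complex.ofReal_mul, Complex.ofReal_cpow h1, Complex.ofReal_cpow hx.1, mul_comm]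
    push_cast
    rfl
  rw [h2] at h
  have h3 : ((t : ℂ) ^ ((b : ℂ) + a - 1)) = ((t ^ (a + b - 1) : ℝ) : ℂ) := by
    rw [Complex.ofReal_cpow ht.le]
    push_cast
    congr 1
    ring
  rw [h3, ← Complex.ofReal_add, Complex.Gamma_ofReal, Complex.Gamma_ofReal,
    Complex.Gamma_ofReal] at h
  norm_cast at h
  rw [h, add_comm b a, mul_comm (Real.Gamma b)]

theorem integral_sub_rpow_mul_sub_rpow {a b r t : ℝ} (ha : 0 < a) (hb : 0 < b) (hrt : r < t) :
    ∫ s in r..t, (t - s) ^ (a - 1) * (s - r) ^ (b - 1) =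
      (t - r) ^ (a + b - 1) * (Real.Gamma a * Real.Gamma b / Real.Gamma (a + b)) := by
  rw [← integral_sub_rpow_mul_rpow ha hb (sub_pos.2 hrt)]
  have h := intervalIntegral.integral_comp_sub_right (a := r) (b := t)
    (fun s : ℝ => (t - r - s) ^ (a - 1) * s ^ (b - 1)) r
  simp only [sub_self] at h
  rw [← h]
  apply intervalIntegral.integral_congr
  intro s _
  simp only
  congr 2
  ring

theorem intervalIntegrable_sub_rpow_mul_sub_rpow {a b r t : ℝ} (ha : 0 < a) (hb : 0 < b)
    (hrt : r < t) :
    IntervalIntegrable (fun s => (t - s) ^ (a - 1) * (s - r) ^ (b - 1)) volume r t := by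
  -- the Bochner integral of a non-integrable function is zero, and this one is not
  apply intervalIntegral.intervalIntegrable_of_integral_ne_zero
  rw [integral_sub_rpow_mul_sub_rpow ha hb hrt]
  have := Real.Gamma_pos_of_pos ha
  have := Real.Gamma_pos_of_pos hb
  have := Real.Gamma_pos_of_pos (add_pos ha hb)
  have := sub_pos.2 hrt
  positivity

theorem fracInt_zero_right {a : ℝ} (f : ℝ → ℝ) : fracInt a f 0 = 0 := by
  simp [fracInt]

/-- The power rule. -/
theorem fracInt_rpow_div_Gamma {a b t : ℝ} (ha : 0 < a) (hb : 0 ≤ b) (ht : 0 ≤ t) :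
    fracInt a (fun s => s ^ b / Real.Gamma (1 + b)) t =
      t ^ (a + b) / Real.Gamma (1 + (a + b)) := by
  rcases ht.eq_or_lt with rfl | ht
  · rw [fracInt_zero_right, Real.zero_rpow (by positivity), zero_div]
  · have h := integral_sub_rpow_mul_rpow ha (by linarith : 0 < 1 + b) ht
    have h1 := (Real.Gamma_pos_of_pos ha).ne'
    have h2 := (Real.Gamma_pos_of_pos (by linarith : 0 < 1 + b)).ne'
    have h3 : ∀ s : ℝ, (t - s) ^ (a - 1) * (s ^ b / Real.Gamma (1 + b)) =
        (Real.Gamma (1 + b))⁻¹ * ((t - s) ^ (a - 1) * s ^ (1 + b - 1)) := by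
      intro s
      rw [add_sub_cancel_left]
      ring
    simp only [fracInt, h3]
    rw [intervalIntegral.integral_const_mul, h, show a + (1 + b) - 1 = a + b by ring,
      show a + (1 + b) = 1 + (a + b) by ring]
    field_simp

theorem fracInt_congr {a t : ℝ} {f g : ℝ → ℝ} (ht : 0 ≤ t) (h : ∀ s, 0 ≤ s → f s = g s) :
    fracInt a f t = fracInt a g t := by
  unfold fracInt
  congr 1
  apply intervalIntegral.integral_congr
  intro s hs
  rw [uIcc_of_le ht] at hs
  simp only [h s hs.1]

theorem fracInt_congr_ae {a t : ℝ} {f g : ℝ → ℝ} (ht : 0 ≤ t)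
    (h : ∀ᵐ s ∂(volume.restrict (Ioi (0 : ℝ))), f s = g s) :
    fracInt a f t = fracInt a g t := by
  unfold fracInt
  congr 1
  rw [intervalIntegral.integral_of_le ht, intervalIntegral.integral_of_le ht]
  apply integral_congr_ae
  have h2 := ae_restrict_of_ae_restrict_of_subset
    (Ioc_subset_Ioi_self : Ioc (0 : ℝ) t ⊆ Ioi 0) h
  filter_upwards [h2] with s hs
  rw [hs]

theorem fracInt_add {a t : ℝ} {f g : ℝ → ℝ} (ha : 0 < a) (ht : 0 ≤ t)
    (hf : ContinuousOn f (Ici 0)) (hg : ContinuousOn g (Ici 0)) :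
    fracInt a (fun s => f s + g s) t = fracInt a f t + fracInt a g t := by
  unfold fracInt
  rw [← mul_add, ← intervalIntegral.integral_add (intervalIntegrable_sub_rpow_mul ha hf ht)
    (intervalIntegrable_sub_rpow_mul ha hg ht)]
  simp only [mul_add]

theorem fracInt_const_mul (a t c : ℝ) (f : ℝ → ℝ) :
    fracInt a (fun s => c * f s) t = c * fracInt a f t := by
  unfold fracInt
  have : ∀ s, (t - s) ^ (a - 1) * (c * f s) = c * ((t - s) ^ (a - 1) * f s) := fun s => by ring
  simp only [this]
  rw [intervalIntegral.integral_const_mul]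
  ring

theorem fracInt_finset_sum {ι : Type*} {a t : ℝ} (ha : 0 < a) (ht : 0 ≤ t) (A : Finset ι)
    {f : ι → ℝ → ℝ} (hf : ∀ i ∈ A, ContinuousOn (f i) (Ici 0)) :
    fracInt a (fun s => ∑ i ∈ A, f i s) t = ∑ i ∈ A, fracInt a (f i) t := by
  unfold fracInt
  rw [← Finset.mul_sum, ← intervalIntegral.integral_finsetSum
    fun i hi => intervalIntegrable_sub_rpow_mul ha (hf i hi) ht]
  simp only [Finset.mul_sum]

theorem integrableOn_rpow_mul_exp_neg {a r : ℝ} (ha : 0 < a) (hr : 0 < r) :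
    IntegrableOn (fun t : ℝ => t ^ (a - 1) * Real.exp (-(r * t))) (Ioi 0) := by
  have h := integrableOn_rpow_mul_exp_neg_mul_rpow (by linarith : -1 < a - 1) one_pos hr
  simpa using h

/-- In the norm `sup e^{-σt} |f t|`, the fractional integral of order `a` has norm at most
`σ^{-a}`. -/
theorem abs_fracInt_le {a σ M t : ℝ} (ha : 0 < a) (hσ : 0 < σ) (ht : 0 ≤ t) {f : ℝ → ℝ}
    (hM : ∀ s, 0 ≤ s → s ≤ t → |f s| ≤ M * Real.exp (σ * s)) :
    |fracInt a f t| ≤ σ ^ (-a) * (M * Real.exp (σ * t)) := by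
  have hG := Real.Gamma_pos_of_pos ha
  have hM0 : 0 ≤ M := by
    have := (abs_nonneg _).trans (hM 0 le_rfl ht)
    simpa using this
  have hc : ContinuousOn (fun s : ℝ => M * Real.exp (σ * s)) (Ici 0) := by fun_prop
  have h1 : |∫ s in (0 : ℝ)..t, (t - s) ^ (a - 1) * f s| ≤
      ∫ s in (0 : ℝ)..t, (t - s) ^ (a - 1) * (M * Real.exp (σ * s)) := by
    rw [← Real.norm_eq_abs]
    apply intervalIntegral.norm_integral_le_of_norm_le ht _
      (intervalIntegrable_sub_rpow_mul ha hc ht)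
    refine Filter.Eventually.of_forall fun s hs => ?_
    have h0 : 0 ≤ (t - s) ^ (a - 1) := Real.rpow_nonneg (by linarith [hs.2]) _
    rw [norm_mul, Real.norm_eq_abs, Real.norm_eq_abs, abs_of_nonneg h0]
    exact mul_le_mul_of_nonneg_left (hM s hs.1.le hs.2) h0
  have h2 : ∫ s in (0 : ℝ)..t, (t - s) ^ (a - 1) * (M * Real.exp (σ * s)) =
      M * Real.exp (σ * t) * ∫ s in (0 : ℝ)..t, s ^ (a - 1) * Real.exp (-(σ * s)) := by
    have h := intervalIntegral.integral_comp_sub_left (a := 0) (b := t)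
      (fun s : ℝ => s ^ (a - 1) * Real.exp (-(σ * s))) t
    simp only [sub_self, sub_zero] at h
    rw [← h, ← intervalIntegral.integral_const_mul]
    apply intervalIntegral.integral_congr
    intro s _
    simp only
    rw [show σ * s = σ * t + -(σ * (t - s)) by ring, Real.exp_add]
    ring
  have h3 : ∫ s in (0 : ℝ)..t, s ^ (a - 1) * Real.exp (-(σ * s)) ≤
      σ ^ (-a) * Real.Gamma a := by
    have h4 := Real.integral_rpow_mul_exp_neg_mul_Ioi ha hσ
    rw [one_div, Real.inv_rpow hσ.le, ← Real.rpow_neg hσ.le] at h4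
    rw [← h4, intervalIntegral.integral_of_le ht]
    apply setIntegral_mono_set (integrableOn_rpow_mul_exp_neg ha hσ)
    · filter_upwards [ae_restrict_mem measurableSet_Ioi] with s hs
      have : (0 : ℝ) ≤ s := le_of_lt hs
      simp only [Pi.zero_apply]
      positivity
    · exact (Ioc_subset_Ioi_self).eventuallyLE
  unfold fracInt
  rw [abs_mul, abs_of_pos (inv_pos.2 hG)]
  calc (Real.Gamma a)⁻¹ * |∫ s in (0 : ℝ)..t, (t - s) ^ (a - 1) * f s|
      ≤ (Real.Gamma a)⁻¹ * (M * Real.exp (σ * t) * (σ ^ (-a) * Real.Gamma a)) := by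
        rw [h2] at h1
        gcongr
        exact h1.trans (by gcongr)
    _ = σ ^ (-a) * (M * Real.exp (σ * t)) := by field_simp

/-- Termwise fractional integration of a series that is dominated by `u i * e^{σ t}`. -/
theorem hasSum_fracInt {a σ t : ℝ} (ha : 0 < a) (ht : 0 ≤ t) {f : ℕ → ℝ → ℝ}
    {F : ℝ → ℝ} {u : ℕ → ℝ} (hu : Summable u) (hf : ∀ i, ContinuousOn (f i) (Ici 0))
    (hb : ∀ i s, 0 ≤ s → |f i s| ≤ u i * Real.exp (σ * s))
    (hF : ∀ s, 0 ≤ s → HasSum (fun i => f i s) (F s)) :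
    HasSum (fun i => fracInt a (f i) t) (fracInt a F t) := by
  unfold fracInt
  apply HasSum.mul_left
  have hbs : ∀ s : ℝ, Summable fun i => (t - s) ^ (a - 1) * (u i * Real.exp (σ * s)) :=
    fun s => (hu.mul_right _).mul_left _
  apply intervalIntegral.hasSum_integral_of_dominated_convergence
    (fun i s => (t - s) ^ (a - 1) * (u i * Real.exp (σ * s)))
  · intro i
    rw [uIoc_of_le ht]
    exact (intervalIntegrable_sub_rpow_mul ha (hf i) ht).1.aestronglyMeasurable
  · intro i
    refine Filter.Eventually.of_forall fun s hs => ?_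
    rw [uIoc_of_le ht] at hs
    have h0 : 0 ≤ (t - s) ^ (a - 1) := Real.rpow_nonneg (by linarith [hs.2]) _
    rw [norm_mul, Real.norm_eq_abs, Real.norm_eq_abs, abs_of_nonneg h0]
    exact mul_le_mul_of_nonneg_left (hb i s hs.1.le) h0
  · exact Filter.Eventually.of_forall fun s _ => hbs s
  · have h1 : ∀ s : ℝ, ∑' i, (t - s) ^ (a - 1) * (u i * Real.exp (σ * s)) =
        (t - s) ^ (a - 1) * ((∑' i, u i) * Real.exp (σ * s)) := fun s => by
      rw [tsum_mul_left, tsum_mul_right]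
    simp only [h1]
    exact intervalIntegrable_sub_rpow_mul ha (by fun_prop) ht
  · refine Filter.Eventually.of_forall fun s hs => ?_
    rw [uIoc_of_le ht] at hs
    exact (hF s hs.1.le).mul_left _

/-- The semigroup law `I^a I^b = I^1` for `a + b = 1`, by Fubini's theorem. -/
theorem fracInt_fracInt {a b t : ℝ} (ha : 0 < a) (hb : 0 < b) (hab : a + b = 1) (ht : 0 ≤ t)
    {φ : ℝ → ℝ} (hm : Measurable φ) (hφ : IntervalIntegrable φ volume 0 t) :
    fracInt a (fracInt b φ) t = ∫ s in (0 : ℝ)..t, φ s := by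
  have hGa := Real.Gamma_pos_of_pos ha
  have hGb := Real.Gamma_pos_of_pos hb
  set ν : Measure ℝ := volume.restrict (Ioc 0 t) with hν
  have hφ' : Integrable φ ν := by
    rwa [intervalIntegrable_iff_integrableOn_Ioc_of_le ht] at hφ
  -- the kernel on the square `(0, t]²`
  set H : ℝ → ℝ → ℝ := fun s r =>
    (Ioi r).indicator (fun s => (t - s) ^ (a - 1) * (s - r) ^ (b - 1)) s * φ r with hH
  have hHm : Measurable (Function.uncurry H) := by
    have h1 : Function.uncurry H = fun p : ℝ × ℝ =>
        {p : ℝ × ℝ | p.2 < p.1}.indicator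
          (fun p => (t - p.1) ^ (a - 1) * (p.1 - p.2) ^ (b - 1)) p * φ p.2 := by
      funext p
      simp only [Function.uncurry, hH, indicator, mem_Ioi, mem_ofPred_eq]
    rw [h1]
    refine Measurable.mul (Measurable.indicator ?_ ?_) (hm.comp measurable_snd)
    · fun_prop
    · exact measurableSet_lt measurable_snd measurable_fst
  have hres : ∀ r, 0 < r → ∀ s, s ∈ Ioc 0 t ∩ Ioi r ↔ s ∈ Ioc r t := by
    intro r hr s
    simp only [mem_inter_iff, mem_Ioc, mem_Ioi]
    constructor
    · rintro ⟨⟨_, h2⟩, h3⟩; exact ⟨h3, h2⟩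
    · rintro ⟨h2, h3⟩; exact ⟨⟨hr.trans h2, h3⟩, h2⟩
  have hker : ∀ r, 0 < r → r < t →
      Integrable ((Ioi r).indicator fun s => (t - s) ^ (a - 1) * (s - r) ^ (b - 1)) ν ∧
      ∫ s, (Ioi r).indicator (fun s => (t - s) ^ (a - 1) * (s - r) ^ (b - 1)) s ∂ν =
        Real.Gamma a * Real.Gamma b := by
    intro r hr hrt
    have hset : Ioi r ∩ Ioc 0 t = Ioc r t := by
      ext s; rw [inter_comm]; exact hres r hr s
    constructor
    · rw [integrable_indicator_iff measurableSet_Ioi, IntegrableOn, hν,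
        Measure.restrict_restrict measurableSet_Ioi, hset]
      have := intervalIntegrable_sub_rpow_mul_sub_rpow ha hb hrt
      rwa [intervalIntegrable_iff_integrableOn_Ioc_of_le hrt.le] at this
    · rw [integral_indicator measurableSet_Ioi, hν, Measure.restrict_restrict measurableSet_Ioi,
        hset, ← intervalIntegral.integral_of_le hrt.le, integral_sub_rpow_mul_sub_rpow ha hb hrt,
        hab]
      simp
  have hae : ∀ᵐ r ∂ν, 0 < r ∧ r < t := by
    have h1 : ∀ᵐ r ∂ν, r ∈ Ioc 0 t := ae_restrict_mem measurableSet_Ioc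
    have h2 : ∀ᵐ r ∂ν, r ≠ t := ae_restrict_of_ae (Measure.ae_ne volume t)
    filter_upwards [h1, h2] with r h3 h4
    exact ⟨h3.1, lt_of_le_of_ne h3.2 h4⟩
  have hnorm : ∀ r s, s ∈ Ioc 0 t → ‖H s r‖ =
      (Ioi r).indicator (fun s => (t - s) ^ (a - 1) * (s - r) ^ (b - 1)) s * ‖φ r‖ := by
    intro r s hs
    rw [hH, norm_mul]
    congr 1
    rw [Real.norm_eq_abs, abs_of_nonneg]
    apply indicator_apply_nonneg
    intro h
    have h1 : 0 ≤ t - s := by linarith [hs.2]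
    have h2 : 0 ≤ s - r := by linarith [mem_Ioi.1 h]
    positivity
  have hint : Integrable (Function.uncurry H) (ν.prod ν) := by
    rw [integrable_prod_iff' hHm.aestronglyMeasurable]
    constructor
    · filter_upwards [hae] with r hr
      exact (hker r hr.1 hr.2).1.mul_const (φ r)
    · refine (hφ'.norm.const_mul (Real.Gamma a * Real.Gamma b)).congr ?_
      filter_upwards [hae] with r hr
      rw [← (hker r hr.1 hr.2).2, ← integral_mul_const]
      apply integral_congr_ae
      filter_upwards [ae_restrict_mem (μ := volume) (measurableSet_Ioc (a := (0 : ℝ)) (b := t))]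
        with s hs
      exact (hnorm r s hs).symm
  have hswap := integral_integral_swap hint
  have hR : ∫ r, ∫ s, H s r ∂ν ∂ν = (Real.Gamma a * Real.Gamma b) * ∫ r, φ r ∂ν := by
    rw [← integral_const_mul]
    apply integral_congr_ae
    filter_upwards [hae] with r hr
    rw [← (hker r hr.1 hr.2).2, ← integral_mul_const]
  have hL : ∫ s, ∫ r, H s r ∂ν ∂ν =
      ∫ s in (0 : ℝ)..t, (t - s) ^ (a - 1) * ∫ r in (0 : ℝ)..s, (s - r) ^ (b - 1) * φ r := by
    rw [intervalIntegral.integral_of_le ht]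
    apply setIntegral_congr_fun measurableSet_Ioc
    intro s hs
    simp only
    have h1 : ∀ r, H s r =
        (Iio s).indicator (fun r => (t - s) ^ (a - 1) * ((s - r) ^ (b - 1) * φ r)) r := by
      intro r
      simp only [hH, indicator, mem_Ioi, mem_Iio]
      split_ifs
      · ring
      · ring
    simp only [h1]
    have hset : Iio s ∩ Ioc 0 t = Ioo 0 s := by
      ext r
      simp only [mem_inter_iff, mem_Iio, mem_Ioc, mem_Ioo]
      constructor
      · rintro ⟨h2, h3, _⟩; exact ⟨h3, h2⟩
      · rintro ⟨h2, h3⟩; exact ⟨h3, h2, (h3.trans_le hs.2).le⟩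
    rw [integral_indicator measurableSet_Iio, hν, Measure.restrict_restrict measurableSet_Iio, hset,
      integral_const_mul, intervalIntegral.integral_of_le hs.1.le, integral_Ioc_eq_integral_Ioo]
  rw [hL, hR] at hswap
  have h5 : ∀ s, (t - s) ^ (a - 1) *
      ((Real.Gamma b)⁻¹ * ∫ r in (0 : ℝ)..s, (s - r) ^ (b - 1) * φ r) =
      (Real.Gamma b)⁻¹ *
        ((t - s) ^ (a - 1) * ∫ r in (0 : ℝ)..s, (s - r) ^ (b - 1) * φ r) := fun s => by ring
  unfold fracInt
  simp only [h5]
  rw [intervalIntegral.integral_const_mul, hswap, intervalIntegral.integral_of_le ht]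
  field_simp
  rfl

/-- The fractional integral inverts the Caputo derivative up to the initial value. -/
theorem fracInt_caputoDeriv {a t : ℝ} (ha : 0 < a) (ha1 : a ≤ 1) (ht : 0 ≤ t) {f : ℝ → ℝ}
    (hf : ∀ T : ℝ, 0 < T → AbsolutelyContinuousOnInterval f 0 T) :
    fracInt a (caputoDeriv a f) t = f t - f 0 := by
  rcases ht.eq_or_lt with rfl | ht
  · rw [fracInt_zero_right, sub_self]
  rw [← (hf t ht).integral_deriv_eq_sub]
  rcases ha1.eq_or_lt with rfl | ha1
  · simp [fracInt, caputoDeriv]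
  · rw [← fracInt_fracInt ha (sub_pos.2 ha1) (by ring) ht.le (measurable_deriv f)
      (hf t ht).intervalIntegrable_deriv]
    apply fracInt_congr ht.le
    intro s _
    rw [caputoDeriv, if_neg ha1.ne, fracInt, show 1 - a - 1 = -a by ring]

/-! ### Positivity of the fractional integral -/

theorem integral_mul_expConvolution_nonneg {c r T : ℝ} (hc : 0 ≤ c) (hr : 0 ≤ r) (hT : 0 ≤ T)
    {w : ℝ → ℝ} (hw : Continuous w) :
    0 ≤ ∫ t in (0 : ℝ)..T, (Real.exp (-(c * t)) * w t) *
      ∫ s in (0 : ℝ)..t, Real.exp (-(r * (t - s))) * w s := by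
  set W : ℝ → ℝ := fun t => ∫ s in (0 : ℝ)..t, Real.exp (r * s) * w s with hW
  have hcont : Continuous fun s => Real.exp (r * s) * w s := by fun_prop
  have hWd : ∀ t, HasDerivAt W (Real.exp (r * t) * w t) t := fun t =>
    intervalIntegral.integral_hasDerivAt_right (hcont.intervalIntegrable _ _)
      hcont.stronglyMeasurable.stronglyMeasurableAtFilter hcont.continuousAt
  have hWc : Continuous W := continuous_iff_continuousAt.2 fun t => (hWd t).continuousAt
  have h1 : ∀ t, (Real.exp (-(c * t)) * w t) *
      ∫ s in (0 : ℝ)..t, Real.exp (-(r * (t - s))) * w s =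
      Real.exp (-((c + r) * t)) * w t * W t := by
    intro t
    have h2 : ∀ s, Real.exp (-(r * (t - s))) * w s =
        Real.exp (-(r * t)) * (Real.exp (r * s) * w s) := by
      intro s
      rw [← mul_assoc, ← Real.exp_add]
      congr 2
      ring
    simp only [h2, hW]
    rw [intervalIntegral.integral_const_mul,
      show -((c + r) * t) = -(c * t) + -(r * t) by ring, Real.exp_add]
    ring
  simp only [h1]
  -- a primitive of the integrand, up to a nonnegative term
  have hGd : ∀ t, HasDerivAt (fun t => Real.exp (-((c + 2 * r) * t)) * (W t ^ 2 / 2))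
      (Real.exp (-((c + r) * t)) * w t * W t
        - (c + 2 * r) / 2 * (Real.exp (-((c + 2 * r) * t)) * W t ^ 2)) t := by
    intro t
    have h2 : HasDerivAt (fun t : ℝ => Real.exp (-((c + 2 * r) * t)))
        (Real.exp (-((c + 2 * r) * t)) * (-((c + 2 * r) * 1))) t :=
      (((hasDerivAt_id t).const_mul (c + 2 * r)).neg).exp
    convert! h2.mul (((hWd t).pow 2).div_const 2) using 1
    rw [show -((c + r) * t) = -((c + 2 * r) * t) + r * t by ring, Real.exp_add]
    simp only [Pi.pow_apply]
    push_cast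
    ring
  have hi1 : Continuous fun t => Real.exp (-((c + r) * t)) * w t * W t := by fun_prop
  have hi2 : Continuous fun t => (c + 2 * r) / 2 * (Real.exp (-((c + 2 * r) * t)) * W t ^ 2) := by
    fun_prop
  have hftc := intervalIntegral.integral_eq_sub_of_hasDerivAt (a := 0) (b := T)
    (fun t _ => hGd t) ((hi1.sub hi2).intervalIntegrable _ _)
  rw [intervalIntegral.integral_sub (hi1.intervalIntegrable _ _) (hi2.intervalIntegrable _ _)]
    at hftc
  have hW0 : W 0 = 0 := by simp [hW]
  have h3 : 0 ≤ ∫ t in (0 : ℝ)..T, (c + 2 * r) / 2 * (Real.exp (-((c + 2 * r) * t)) * W t ^ 2) :=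
    intervalIntegral.integral_nonneg hT fun t _ => by positivity
  have h4 : 0 ≤ Real.exp (-((c + 2 * r) * T)) * (W T ^ 2 / 2) := by positivity
  rw [hW0] at hftc
  nlinarith

/-- A bilinear form with convolution kernel `κ` on `(0, T]`, as an integral over the plane; the
indicator of `(0, T]` at `p.1 - p.2` cuts out the triangle `p.2 < p.1`. -/
theorem bilinearForm_prod_eq {T : ℝ} (hT : 0 ≤ T) {v w κ : ℝ → ℝ} (hv : Continuous v)
    (hw : Continuous w) (hκ : IntegrableOn κ (Ioc 0 T)) :
    Integrable (fun p : ℝ × ℝ => (Ioc 0 T).indicator v p.1 *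
      ((Ioc 0 T).indicator w p.2 * (Ioc 0 T).indicator κ (p.1 - p.2))) (volume.prod volume) ∧
    ∫ p : ℝ × ℝ, (Ioc 0 T).indicator v p.1 *
      ((Ioc 0 T).indicator w p.2 * (Ioc 0 T).indicator κ (p.1 - p.2)) =
      ∫ t in (0 : ℝ)..T, v t * ∫ s in (0 : ℝ)..t, κ (t - s) * w s := by
  have hw' : Integrable ((Ioc 0 T).indicator w) :=
    ((hw.integrableOn_Icc (a := 0) (b := T)).mono_set Ioc_subset_Icc_self).integrable_indicator
      measurableSet_Ioc
  have hκ' : Integrable ((Ioc 0 T).indicator κ) := hκ.integrable_indicator measurableSet_Ioc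
  have h1 := hw'.convolution_integrand (ContinuousLinearMap.mul ℝ ℝ) hκ'
  obtain ⟨C, hC⟩ := (isCompact_Icc (a := (0 : ℝ)) (b := T)).exists_bound_of_continuousOn
    hv.continuousOn
  have hint : Integrable (fun p : ℝ × ℝ => (Ioc 0 T).indicator v p.1 *
      ((Ioc 0 T).indicator w p.2 * (Ioc 0 T).indicator κ (p.1 - p.2))) (volume.prod volume) := by
    apply h1.bdd_mul (c := |C|)
    · exact ((hv.measurable.indicator measurableSet_Ioc).comp measurable_fst).aestronglyMeasurable
    · refine Filter.Eventually.of_forall fun p => ?_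
      by_cases hp : p.1 ∈ Ioc 0 T
      · rw [indicator_of_mem hp]
        exact (hC _ (Ioc_subset_Icc_self hp)).trans (le_abs_self _)
      · rw [indicator_of_notMem hp]
        simp
  refine ⟨hint, ?_⟩
  rw [Measure.volume_eq_prod, integral_prod _ hint, intervalIntegral.integral_of_le hT,
    ← integral_indicator measurableSet_Ioc]
  congr 1
  funext t
  by_cases ht : t ∈ Ioc 0 T
  · simp only
    rw [indicator_of_mem ht, integral_const_mul, indicator_of_mem ht]
    congr 1
    rw [intervalIntegral.integral_of_le ht.1.le, integral_Ioc_eq_integral_Ioo,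
      ← integral_indicator measurableSet_Ioo]
    congr 1
    funext s
    by_cases hs : s ∈ Ioo 0 t
    · rw [indicator_of_mem hs, indicator_of_mem (show s ∈ Ioc 0 T from ⟨hs.1, (hs.2.trans_le ht.2).le⟩),
        indicator_of_mem (show t - s ∈ Ioc 0 T from ⟨sub_pos.2 hs.2, by linarith [hs.1, ht.2]⟩),
        mul_comm]
    · rw [indicator_of_notMem hs]
      by_cases h0 : 0 < s
      · rw [indicator_of_notMem (s := Ioc 0 T) (a := t - s)
          (fun h => hs ⟨h0, by linarith [h.1]⟩), mul_zero]
      · rw [indicator_of_notMem (s := Ioc 0 T) (a := s) (fun h => h0 h.1), zero_mul]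
  · simp [ht]

theorem integral_mul_fracInt_nonneg_of_continuous {a c T : ℝ} (ha : 0 < a) (ha1 : a ≤ 1)
    (hc : 0 ≤ c) (hT : 0 ≤ T) {w : ℝ → ℝ} (hw : Continuous w) :
    0 ≤ ∫ t in (0 : ℝ)..T, (Real.exp (-(c * t)) * w t) *
      ∫ s in (0 : ℝ)..t, (t - s) ^ (a - 1) * w s := by
  rcases ha1.eq_or_lt with rfl | ha1
  · simpa using integral_mul_expConvolution_nonneg hc le_rfl hT hw
  have hv : Continuous fun t => Real.exp (-(c * t)) * w t := by fun_prop
  set v : ℝ → ℝ := fun t => Real.exp (-(c * t)) * w t with hvdef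
  have hG := Real.Gamma_pos_of_pos (sub_pos.2 ha1)
  have hκ : IntegrableOn (fun r : ℝ => r ^ (a - 1)) (Ioc 0 T) := by
    have h := intervalIntegral.intervalIntegrable_rpow' (a := 0) (b := T)
      (by linarith : -1 < a - 1)
    rwa [intervalIntegrable_iff_integrableOn_Ioc_of_le hT] at h
  obtain ⟨hi, he⟩ := bilinearForm_prod_eq hT hv hw hκ
  rw [← he]
  -- `(t - s)^(a - 1)` is a mixture of the kernels `exp (-(r * (t - s)))`, `r > 0`
  set H : ℝ × ℝ → ℝ → ℝ := fun p r => ((Ioc 0 T).indicator v p.1 *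
    ((Ioc 0 T).indicator w p.2 * (Ioc 0 T).indicator (fun _ => (1 : ℝ)) (p.1 - p.2))) *
      (r ^ (1 - a - 1) * Real.exp (-((p.1 - p.2) * r))) with hH
  have hHm : Measurable (Function.uncurry H) := by
    have h1 := hv.measurable.indicator (measurableSet_Ioc (a := (0 : ℝ)) (b := T))
    have h2 := hw.measurable.indicator (measurableSet_Ioc (a := (0 : ℝ)) (b := T))
    have h3 : Measurable ((Ioc 0 T).indicator fun _ : ℝ => (1 : ℝ)) :=
      measurable_const.indicator measurableSet_Ioc
    have h4 : Measurable fun p : ℝ × ℝ => (Ioc 0 T).indicator v p.1 *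
        ((Ioc 0 T).indicator w p.2 * (Ioc 0 T).indicator (fun _ => (1 : ℝ)) (p.1 - p.2)) :=
      (h1.comp measurable_fst).mul ((h2.comp measurable_snd).mul
        (h3.comp (measurable_fst.sub measurable_snd)))
    exact (h4.comp measurable_fst).mul (by fun_prop)
  have hker : ∀ p : ℝ × ℝ, p.1 - p.2 ∈ Ioc 0 T →
      ∫ r in Ioi (0 : ℝ), r ^ (1 - a - 1) * Real.exp (-((p.1 - p.2) * r)) =
        (p.1 - p.2) ^ (a - 1) * Real.Gamma (1 - a) := by
    intro p hp
    rw [Real.integral_rpow_mul_exp_neg_mul_Ioi (sub_pos.2 ha1) hp.1, one_div,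
      Real.inv_rpow hp.1.le, ← Real.rpow_neg hp.1.le, neg_sub]
  have hHi : Integrable (Function.uncurry H)
      ((volume.prod volume).prod (volume.restrict (Ioi 0))) := by
    rw [integrable_prod_iff hHm.aestronglyMeasurable]
    constructor
    · refine Filter.Eventually.of_forall fun p => ?_
      simp only [Function.uncurry, hH]
      by_cases hp : p.1 - p.2 ∈ Ioc 0 T
      · exact (integrableOn_rpow_mul_exp_neg (sub_pos.2 ha1) hp.1).const_mul _
      · simp [indicator_of_notMem hp]
    · refine (hi.norm.mul_const (Real.Gamma (1 - a))).congr (Filter.Eventually.of_forall fun p => ?_)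
      simp only [Function.uncurry, hH]
      by_cases hp : p.1 - p.2 ∈ Ioc 0 T
      · have h1 : ∀ᵐ r ∂(volume.restrict (Ioi (0 : ℝ))),
            ‖r ^ (1 - a - 1) * Real.exp (-((p.1 - p.2) * r))‖ =
              r ^ (1 - a - 1) * Real.exp (-((p.1 - p.2) * r)) := by
          filter_upwards [ae_restrict_mem measurableSet_Ioi] with r hr
          have : (0 : ℝ) ≤ r := le_of_lt hr
          rw [Real.norm_eq_abs, abs_of_nonneg (by positivity)]
        simp only [norm_mul _ (_ * Real.exp _)]
        rw [integral_const_mul, integral_congr_ae h1, hker p hp]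
        simp only [indicator_of_mem hp, norm_mul, mul_one]
        rw [Real.norm_eq_abs ((p.1 - p.2) ^ (a - 1)),
          abs_of_nonneg (Real.rpow_nonneg hp.1.le _)]
        ring
      · simp [indicator_of_notMem hp]
  have hswap := integral_integral_swap hHi
  have hL : ∫ p, (∫ r in Ioi (0 : ℝ), H p r) ∂(volume.prod volume) =
      (∫ p : ℝ × ℝ, (Ioc 0 T).indicator v p.1 * ((Ioc 0 T).indicator w p.2 *
        (Ioc 0 T).indicator (fun r : ℝ => r ^ (a - 1)) (p.1 - p.2))) * Real.Gamma (1 - a) := by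
    rw [← integral_mul_const, Measure.volume_eq_prod]
    congr 1
    funext p
    simp only [hH]
    rw [integral_const_mul]
    by_cases hp : p.1 - p.2 ∈ Ioc 0 T
    · rw [hker p hp, indicator_of_mem hp, indicator_of_mem hp]
      ring
    · simp [indicator_of_notMem hp]
  have hR : 0 ≤ ∫ r in Ioi (0 : ℝ), (∫ p, H p r ∂(volume.prod volume)) := by
    apply setIntegral_nonneg measurableSet_Ioi
    intro r hr
    have hr0 : (0 : ℝ) ≤ r := le_of_lt hr
    have hκr : Continuous fun x : ℝ => Real.exp (-(r * x)) := by fun_prop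
    have h1 := (bilinearForm_prod_eq hT hv hw
      ((hκr.integrableOn_Icc (a := 0) (b := T)).mono_set Ioc_subset_Icc_self)).2
    have h2 : ∀ p : ℝ × ℝ, H p r = r ^ (1 - a - 1) * ((Ioc 0 T).indicator v p.1 *
        ((Ioc 0 T).indicator w p.2 *
          (Ioc 0 T).indicator (fun x : ℝ => Real.exp (-(r * x))) (p.1 - p.2))) := by
      intro p
      simp only [hH]
      by_cases hp : p.1 - p.2 ∈ Ioc 0 T
      · rw [indicator_of_mem hp, indicator_of_mem hp, mul_comm r]
        ring
      · simp [indicator_of_notMem hp]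
    simp only [h2]
    rw [integral_const_mul, ← Measure.volume_eq_prod, h1]
    exact mul_nonneg (Real.rpow_nonneg hr0 _) (integral_mul_expConvolution_nonneg hc hr0 hT hw)
  rw [← hswap, hL] at hR
  exact nonneg_of_mul_nonneg_left hR hG

/-- Fractional integration of order at most one is a positive operator on the `L²` space with
weight `e^{-ct}`: its kernel is a mixture of the kernels `e^{-r(t - s)}`, `r > 0`, for which the
form is, up to a nonnegative term, the integral of a derivative. -/
theorem integral_mul_fracInt_nonneg {a c T : ℝ} (ha : 0 < a) (ha1 : a ≤ 1)
    (hc : 0 ≤ c) (hT : 0 ≤ T) {w : ℝ → ℝ} (hw : ContinuousOn w (Ici 0)) :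
    0 ≤ ∫ t in (0 : ℝ)..T, Real.exp (-(c * t)) * w t * fracInt a w t := by
  have hw' : Continuous fun t => w (max 0 t) :=
    hw.comp_continuous (by fun_prop) fun t => le_max_left 0 t
  have h := integral_mul_fracInt_nonneg_of_continuous ha ha1 hc hT hw'
  have h2 : ∫ t in (0 : ℝ)..T, Real.exp (-(c * t)) * w t * fracInt a w t =
      (Real.Gamma a)⁻¹ * ∫ t in (0 : ℝ)..T, (Real.exp (-(c * t)) * w (max 0 t)) *
      ∫ s in (0 : ℝ)..t, (t - s) ^ (a - 1) * w (max 0 s) := by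
    rw [← intervalIntegral.integral_const_mul]
    apply intervalIntegral.integral_congr
    intro t ht
    rw [uIcc_of_le hT] at ht
    simp only
    rw [fracInt_congr (g := fun s => w (max 0 s)) ht.1 (fun s hs => by rw [max_eq_right hs]),
      max_eq_right ht.1, fracInt]
    ring
  rw [h2]
  exact mul_nonneg (inv_nonneg.2 (Real.Gamma_pos_of_pos ha).le) h

/-! ### The fractional relaxation equation and Laplace transforms -/

/-- If `u = I^a (g - μ u)`, the norm of `u` in the `L²` spaces with exponential weights is at
most `μ⁻¹` times that of `g`. -/
theorem integrableOn_exp_mul_sq_of_relaxation {a μ : ℝ} (ha : 0 < a) (ha1 : a ≤ 1) (hμ : 0 < μ)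
    {u g : ℝ → ℝ} (hu : ContinuousOn u (Ici 0)) (hg : ContinuousOn g (Ici 0))
    (h : ∀ t, 0 ≤ t → u t = fracInt a (fun s => g s - μ * u s) t) {c : ℝ} (hc : 0 < c)
    (hgi : IntegrableOn (fun t => Real.exp (-(c * t)) * g t ^ 2) (Ioi 0)) :
    IntegrableOn (fun t => Real.exp (-(c * t)) * u t ^ 2) (Ioi 0) := by
  have hcu : ContinuousOn (fun t => Real.exp (-(c * t)) * u t ^ 2) (Ici 0) := by fun_prop
  have hcg : ContinuousOn (fun t => Real.exp (-(c * t)) * g t ^ 2) (Ici 0) := by fun_prop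
  have hiv : ∀ {f : ℝ → ℝ} {T : ℝ}, 0 ≤ T → ContinuousOn f (Ici 0) →
      IntervalIntegrable f volume 0 T := by
    intro f T hT hf
    apply (hf.mono _).intervalIntegrable
    rw [uIcc_of_le hT]
    exact Icc_subset_Ici_self
  apply integrableOn_Ioi_of_intervalIntegral_norm_bounded (l := Filter.atTop) (b := fun T : ℝ => T)
    (μ⁻¹ ^ 2 * ∫ t in Ioi (0 : ℝ), Real.exp (-(c * t)) * g t ^ 2) 0
  · intro T
    rcases le_total 0 T with hT | hT
    · exact (intervalIntegrable_iff_integrableOn_Ioc_of_le hT).1 (hiv hT hcu)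
    · rw [Ioc_eq_empty (not_lt.2 hT)]
      exact integrableOn_empty
  · exact Filter.tendsto_id
  · filter_upwards [Filter.eventually_ge_atTop 0] with T hT
    have hpos := integral_mul_fracInt_nonneg ha ha1 hc.le hT
      (by fun_prop : ContinuousOn (fun s => g s - μ * u s) (Ici 0))
    have h1 : ∫ t in (0 : ℝ)..T, Real.exp (-(c * t)) * (g t - μ * u t) *
        fracInt a (fun s => g s - μ * u s) t ≤
        ∫ t in (0 : ℝ)..T, ((2 * μ)⁻¹ * (Real.exp (-(c * t)) * g t ^ 2)
          - μ / 2 * (Real.exp (-(c * t)) * u t ^ 2)) := by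
      have h2 : ∫ t in (0 : ℝ)..T, Real.exp (-(c * t)) * (g t - μ * u t) *
          fracInt a (fun s => g s - μ * u s) t =
          ∫ t in (0 : ℝ)..T, Real.exp (-(c * t)) * (g t - μ * u t) * u t := by
        apply intervalIntegral.integral_congr
        intro t ht
        rw [uIcc_of_le hT] at ht
        simp only
        rw [← h t ht.1]
      rw [h2]
      apply intervalIntegral.integral_mono_on hT
      · exact hiv hT (by fun_prop)
      · exact hiv hT (by fun_prop)
      · intro t _
        have h3 : (g t - μ * u t) * u t ≤ (2 * μ)⁻¹ * g t ^ 2 - μ / 2 * u t ^ 2 := by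
          have h4 : (2 * μ)⁻¹ * g t ^ 2 - μ / 2 * u t ^ 2 - (g t - μ * u t) * u t =
              (2 * μ)⁻¹ * (g t - μ * u t) ^ 2 := by
            field_simp
            ring
          have : 0 ≤ (2 * μ)⁻¹ * (g t - μ * u t) ^ 2 := by positivity
          linarith
        have := mul_le_mul_of_nonneg_left h3 (Real.exp_pos (-(c * t))).le
        linarith
    rw [intervalIntegral.integral_sub ((hiv hT hcg).const_mul _) ((hiv hT hcu).const_mul _),
      intervalIntegral.integral_const_mul, intervalIntegral.integral_const_mul] at h1
    have h5 : ∫ t in (0 : ℝ)..T, Real.exp (-(c * t)) * g t ^ 2 ≤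
        ∫ t in Ioi (0 : ℝ), Real.exp (-(c * t)) * g t ^ 2 := by
      rw [intervalIntegral.integral_of_le hT]
      apply setIntegral_mono_set hgi
      · exact Filter.Eventually.of_forall fun t => by simp only [Pi.zero_apply]; positivity
      · exact Ioc_subset_Ioi_self.eventuallyLE
    have h6 : ∀ t, ‖Real.exp (-(c * t)) * u t ^ 2‖ = Real.exp (-(c * t)) * u t ^ 2 := fun t => by
      rw [Real.norm_eq_abs, abs_of_nonneg (by positivity)]
    simp only [h6]
    have h7 := hpos.trans h1
    have h8 : μ / 2 * (∫ t in (0 : ℝ)..T, Real.exp (-(c * t)) * u t ^ 2) ≤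
        (2 * μ)⁻¹ * ∫ t in Ioi (0 : ℝ), Real.exp (-(c * t)) * g t ^ 2 := by
      have : (2 * μ)⁻¹ * (∫ t in (0 : ℝ)..T, Real.exp (-(c * t)) * g t ^ 2) ≤
        (2 * μ)⁻¹ * ∫ t in Ioi (0 : ℝ), Real.exp (-(c * t)) * g t ^ 2 := by gcongr
      linarith
    have h9 := mul_le_mul_of_nonneg_left h8 (by positivity : 0 ≤ 2 / μ)
    calc ∫ t in (0 : ℝ)..T, Real.exp (-(c * t)) * u t ^ 2
        = 2 / μ * (μ / 2 * ∫ t in (0 : ℝ)..T, Real.exp (-(c * t)) * u t ^ 2) := by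
          field_simp
      _ ≤ _ := h9
      _ = _ := by field_simp

theorem integrableOn_exp_mul_of_sq {u : ℝ → ℝ} (hu : ContinuousOn u (Ici 0)) {c : ℝ} (hc : 0 < c)
    (h : IntegrableOn (fun t => Real.exp (-(c * t)) * u t ^ 2) (Ioi 0)) :
    IntegrableOn (fun t => Real.exp (-(c * t)) * u t) (Ioi 0) := by
  have h1 : IntegrableOn (fun t => Real.exp (-(c * t))) (Ioi 0) := by
    have := integrableOn_exp_mul_Ioi (a := -c) (by linarith) 0
    simpa only [neg_mul] using this
  refine (h1.add h).mono' ?_ (Filter.Eventually.of_forall fun t => ?_)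
  · have hcu : ContinuousOn (fun t => Real.exp (-(c * t)) * u t) (Ici 0) := by fun_prop
    exact (hcu.mono Ioi_subset_Ici_self).aestronglyMeasurable measurableSet_Ioi
  · have h2 : |u t| ≤ 1 + u t ^ 2 := by
      rw [← sq_abs (u t)]
      nlinarith [sq_nonneg (|u t| - 1), abs_nonneg (u t)]
    rw [norm_mul, Real.norm_eq_abs, Real.norm_eq_abs, Real.abs_exp]
    have := mul_le_mul_of_nonneg_left h2 (Real.exp_pos (-(c * t))).le
    simp only [Pi.add_apply]
    linarith

/-- Fractional integration of order `a` multiplies the Laplace transform by `s^{-a}`. -/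
theorem laplace_fracInt {a s : ℝ} (ha : 0 < a) (hs : 0 < s) {w : ℝ → ℝ}
    (hw : IntegrableOn (fun t => Real.exp (-(s * t)) * w t) (Ioi 0)) :
    ∫ t in Ioi (0 : ℝ), Real.exp (-(s * t)) * fracInt a w t =
      s ^ (-a) * ∫ t in Ioi (0 : ℝ), Real.exp (-(s * t)) * w t := by
  have hG := (Real.Gamma_pos_of_pos ha).ne'
  have h := integral_posConvolution hw (integrableOn_rpow_mul_exp_neg ha hs)
    (ContinuousLinearMap.mul ℝ ℝ)
  simp only [ContinuousLinearMap.mul_apply'] at h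
  rw [Real.integral_rpow_mul_exp_neg_mul_Ioi ha hs, one_div, Real.inv_rpow hs.le,
    ← Real.rpow_neg hs.le] at h
  have h1 : ∀ t, Real.exp (-(s * t)) * fracInt a w t = (Real.Gamma a)⁻¹ *
      ∫ r in (0 : ℝ)..t, Real.exp (-(s * r)) * w r *
        ((t - r) ^ (a - 1) * Real.exp (-(s * (t - r)))) := by
    intro t
    unfold fracInt
    rw [mul_left_comm, ← intervalIntegral.integral_const_mul]
    congr 2
    funext r
    rw [show -(s * t) = -(s * r) + -(s * (t - r)) by ring, Real.exp_add]
    ring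
  simp only [h1]
  rw [integral_const_mul, h]
  field_simp

/-- The relaxation equation `u = I^a (g - μ u)` on the side of the Laplace transforms. -/
theorem laplace_relaxation {a μ s : ℝ} (ha : 0 < a) (hμ : 0 < μ) (hs : 0 < s)
    {u g : ℝ → ℝ} (h : ∀ t, 0 ≤ t → u t = fracInt a (fun s => g s - μ * u s) t)
    (hg : IntegrableOn (fun t => Real.exp (-(s * t)) * g t) (Ioi 0))
    (hu : IntegrableOn (fun t => Real.exp (-(s * t)) * u t) (Ioi 0)) :
    ∫ t in Ioi (0 : ℝ), Real.exp (-(s * t)) * u t =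
      (∫ t in Ioi (0 : ℝ), Real.exp (-(s * t)) * g t) / (s ^ a + μ) := by
  have h1 : ∀ t, Real.exp (-(s * t)) * (g t - μ * u t) =
      Real.exp (-(s * t)) * g t - μ * (Real.exp (-(s * t)) * u t) := fun t => by ring
  have hw : IntegrableOn (fun t => Real.exp (-(s * t)) * (g t - μ * u t)) (Ioi 0) := by
    simp only [h1]
    exact hg.sub (hu.const_mul μ)
  have h2 := laplace_fracInt ha hs hw
  simp only [h1] at h2
  rw [integral_sub hg (hu.const_mul μ), integral_const_mul] at h2
  have h3 : ∫ t in Ioi (0 : ℝ), Real.exp (-(s * t)) * fracInt a (fun s => g s - μ * u s) t =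
      ∫ t in Ioi (0 : ℝ), Real.exp (-(s * t)) * u t := by
    apply setIntegral_congr_fun measurableSet_Ioi
    intro t ht
    simp only
    rw [← h t (le_of_lt ht)]
  rw [h3, Real.rpow_neg hs.le] at h2
  have h4 : 0 < s ^ a := Real.rpow_pos_of_pos hs a
  rw [eq_div_iff (by positivity)]
  field_simp at h2
  linarith

theorem integral_Ioi_exp_neg_mul {s : ℝ} (hs : 0 < s) :
    IntegrableOn (fun t => Real.exp (-(s * t))) (Ioi 0) ∧
      ∫ t in Ioi (0 : ℝ), Real.exp (-(s * t)) = 1 / s := by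
  have h1 := integrableOn_exp_mul_Ioi (a := -s) (by linarith) 0
  have h2 := integral_exp_mul_Ioi (a := -s) (by linarith) 0
  simp only [neg_mul] at h1 h2
  refine ⟨h1, ?_⟩
  rw [h2]
  simp

/-! ### Uniqueness for the Laplace transform and for the relaxation equation -/

/-- Lerch's theorem for continuous functions: under `x = e^{-t}` the Laplace transform at the
positive integers becomes the sequence of moments on `[0, 1]`, and polynomials are dense there. -/
theorem eq_zero_of_laplace_eq_zero {h : ℝ → ℝ} (hc : ContinuousOn h (Ici 0))
    (hi : ∀ s : ℝ, 0 < s → IntegrableOn (fun t => Real.exp (-(s * t)) * h t) (Ioi 0))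
    (h0 : ∀ s : ℝ, 0 < s → ∫ t in Ioi (0 : ℝ), Real.exp (-(s * t)) * h t = 0)
    {t : ℝ} (ht : 0 ≤ t) : h t = 0 := by
  set H : ℝ → ℝ := fun t => Real.exp (-(1 * t)) * h t with hH
  have hHi : IntegrableOn H (Ioi 0) := hi 1 one_pos
  have hpow : ∀ (n : ℕ) (t : ℝ), Real.exp (-t) ^ n * H t = Real.exp (-((n + 1) * t)) * h t := by
    intro n t
    rw [hH, ← Real.exp_nat_mul, ← mul_assoc, ← Real.exp_add]
    congr 2
    ring
  have hpoly : ∀ p : Polynomial ℝ, IntegrableOn (fun t => p.eval (Real.exp (-t)) * H t) (Ioi 0) ∧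
      ∫ t in Ioi (0 : ℝ), p.eval (Real.exp (-t)) * H t = 0 := by
    intro p
    have h1 : ∀ t, p.eval (Real.exp (-t)) * H t =
        ∑ i ∈ Finset.range (p.natDegree + 1),
          p.coeff i * (Real.exp (-((i + 1) * t)) * h t) := by
      intro t
      rw [Polynomial.eval_eq_sum_range, Finset.sum_mul]
      refine Finset.sum_congr rfl fun i _ => ?_
      rw [← hpow, mul_assoc]
    have h2 : ∀ i : ℕ, Integrable (fun t => p.coeff i * (Real.exp (-((i + 1) * t)) * h t))
        (volume.restrict (Ioi 0)) := fun i => (hi (i + 1) (by positivity)).const_mul _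
    simp only [h1]
    refine ⟨integrable_finsetSum _ fun i _ => h2 i, ?_⟩
    rw [integral_finsetSum _ fun i _ => h2 i]
    refine Finset.sum_eq_zero fun i _ => ?_
    rw [integral_const_mul, h0 _ (by positivity), mul_zero]
  have hae : ∀ᵐ t, t ∈ Ioi (0 : ℝ) → H t = 0 := by
    apply isOpen_Ioi.ae_eq_zero_of_integral_contDiff_smul_eq_zero hHi.locallyIntegrableOn
    intro φ hφ hφc hφs
    have hφ0 : ∀ t, t ∉ Ioi (0 : ℝ) → φ t = 0 := fun t ht =>
      image_eq_zero_of_notMem_tsupport fun h => ht (hφs h)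
    obtain ⟨R, hR⟩ := hφc.isCompact.isBounded.subset_closedBall 0
    have hφR : ∀ t, R < t → φ t = 0 := fun t ht =>
      image_eq_zero_of_notMem_tsupport fun h => by
        have := hR h
        rw [Metric.mem_closedBall, dist_zero_right, Real.norm_eq_abs] at this
        linarith [le_abs_self t]
    -- the test function in the variable `x = e^{-t}`
    have hψ : ContinuousOn (fun x : ℝ => φ (-Real.log x)) (Icc 0 1) := by
      intro x hx
      apply ContinuousAt.continuousWithinAt
      rcases hx.1.eq_or_lt with rfl | hx0
      · have hev : (fun x : ℝ => φ (-Real.log x)) =ᶠ[nhds 0] fun _ => 0 := by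
          have h1 : ∀ᶠ x in nhds (0 : ℝ), |x| < Real.exp (-(|R| + 1)) :=
            (continuous_abs.tendsto' 0 0 abs_zero).eventually_lt_const (Real.exp_pos _)
          filter_upwards [h1] with x hx
          rcases eq_or_ne x 0 with rfl | hne
          · rw [Real.log_zero, neg_zero]
            exact hφ0 0 (by simp)
          · apply hφR
            have h2 : Real.log x < -(|R| + 1) := by
              rw [← Real.log_abs]
              exact (Real.log_lt_iff_lt_exp (abs_pos.2 hne)).2 hx
            linarith [le_abs_self R]
        exact continuousAt_const.congr hev.symm
      · exact hφ.continuous.continuousAt.comp (Real.continuousAt_log hx0.ne').neg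
    have hset : ∫ t, φ t • H t = ∫ t in Ioi (0 : ℝ), φ t * H t := by
      rw [← integral_indicator measurableSet_Ioi]
      congr 1
      funext t
      by_cases ht : t ∈ Ioi (0 : ℝ)
      · rw [indicator_of_mem ht, smul_eq_mul]
      · rw [indicator_of_notMem ht, hφ0 t ht, zero_smul]
    rw [hset]
    obtain ⟨C, hC⟩ := hφ.continuous.bounded_above_of_compact_support hφc
    have hφH : IntegrableOn (fun t => φ t * H t) (Ioi 0) :=
      hHi.bdd_mul hφ.continuous.aestronglyMeasurable (Filter.Eventually.of_forall hC)
    set A := ∫ t in Ioi (0 : ℝ), ‖H t‖ with hA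
    have hA0 : 0 ≤ A := integral_nonneg fun t => norm_nonneg _
    have hle : ∀ ε : ℝ, 0 < ε → |∫ t in Ioi (0 : ℝ), φ t * H t| ≤ ε * A := by
      intro ε hε
      obtain ⟨p, hp⟩ := exists_polynomial_near_of_continuousOn 0 1 _ hψ ε hε
      have h1 : ∫ t in Ioi (0 : ℝ), φ t * H t =
          ∫ t in Ioi (0 : ℝ), (φ t * H t - p.eval (Real.exp (-t)) * H t) := by
        rw [integral_sub hφH (hpoly p).1, (hpoly p).2, sub_zero]
      rw [h1, ← Real.norm_eq_abs, hA, ← integral_const_mul]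
      apply norm_integral_le_of_norm_le (hHi.norm.const_mul ε)
      filter_upwards [ae_restrict_mem measurableSet_Ioi] with t ht
      have h2 := hp (Real.exp (-t))
        ⟨(Real.exp_pos _).le, Real.exp_le_one_iff.2 (by linarith [mem_Ioi.1 ht])⟩
      rw [Real.log_exp, neg_neg, abs_sub_comm] at h2
      rw [← sub_mul, norm_mul]
      exact mul_le_mul_of_nonneg_right h2.le (norm_nonneg _)
    rw [← abs_nonpos_iff]
    apply le_of_forall_pos_le_add
    intro ε hε
    have h3 := hle (ε / (A + 1)) (by positivity)
    have h4 : ε / (A + 1) * A ≤ ε := by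
      rw [div_mul_eq_mul_div, div_le_iff₀ (by positivity)]
      nlinarith
    linarith
  have hh : ∀ᵐ t ∂(volume.restrict (Ioi (0 : ℝ))), h t = 0 := by
    rw [ae_restrict_iff' measurableSet_Ioi]
    filter_upwards [hae] with t ht h1
    exact (mul_eq_zero.1 (ht h1)).resolve_left (Real.exp_pos _).ne'
  have heq : EqOn h (fun _ => 0) (Ioi 0) :=
    Measure.eqOn_open_of_ae_eq hh isOpen_Ioi (hc.mono Ioi_subset_Ici_self) continuousOn_const
  have hcl : EqOn h (fun _ => 0) (Ici 0) :=
    heq.of_subset_closure hc continuousOn_const Ioi_subset_Ici_self (by rw [closure_Ioi])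
  exact hcl ht

theorem IsInverseLaplace.eq_of_nonneg {F f g : ℝ → ℝ} (hf : IsInverseLaplace F f)
    (hg : IsInverseLaplace F g) {t : ℝ} (ht : 0 ≤ t) : f t = g t := by
  have h1 : ∀ s t, Real.exp (-(s * t)) * (f t - g t) =
      Real.exp (-(s * t)) * f t - Real.exp (-(s * t)) * g t := fun s t => by ring
  rw [← sub_eq_zero]
  apply eq_zero_of_laplace_eq_zero (h := fun t => f t - g t) (hf.1.sub hg.1) _ _ ht
  · intro s hs
    simp only [h1]
    exact (hf.2 s hs).1.sub (hg.2 s hs).1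
  · intro s hs
    simp only [h1]
    rw [integral_sub (hf.2 s hs).1 (hg.2 s hs).1, (hf.2 s hs).2, (hg.2 s hs).2, sub_self]

theorem isInverseLaplace_inverseLaplace {F f : ℝ → ℝ} (hf : IsInverseLaplace F f) :
    IsInverseLaplace F (inverseLaplace F) := by
  have h : ∃ f, IsInverseLaplace F f := ⟨f, hf⟩
  rw [inverseLaplace, dif_pos h]
  exact h.choose_spec

theorem eventually_mul_rpow_neg_le {a ε : ℝ} (ha : 0 < a) (hε : 0 < ε) (μ : ℝ) :
    ∀ᶠ σ : ℝ in Filter.atTop, μ * σ ^ (-a) ≤ ε := by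
  have h := (tendsto_rpow_neg_atTop ha).const_mul μ
  rw [mul_zero] at h
  exact h.eventually_le_const hε

/-- The equation `v = -μ I^a v` has only the zero solution, by contraction in a weighted
supremum norm. -/
theorem eq_zero_of_relaxation {a μ : ℝ} (ha : 0 < a) (hμ : 0 < μ) {v : ℝ → ℝ}
    (hv : ContinuousOn v (Ici 0)) (h : ∀ t, 0 ≤ t → v t = -(μ * fracInt a v t))
    {t : ℝ} (ht : 0 ≤ t) : v t = 0 := by
  obtain ⟨σ, hσ, hσ0⟩ := ((eventually_mul_rpow_neg_le ha (by norm_num : (0 : ℝ) < 1 / 2) μ).and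
    (Filter.eventually_gt_atTop 0)).exists
  have hc : ContinuousOn (fun s => Real.exp (-(σ * s)) * |v s|) (Icc 0 t) := by
    have := hv.mono (Icc_subset_Ici_self : Icc 0 t ⊆ Ici 0)
    fun_prop
  obtain ⟨r, hr, hmax⟩ := isCompact_Icc.exists_isMaxOn ⟨0, left_mem_Icc.2 ht⟩ hc
  set M := Real.exp (-(σ * r)) * |v r| with hM
  have hM0 : 0 ≤ M := by positivity
  have hle : ∀ s, 0 ≤ s → s ≤ t → |v s| ≤ M * Real.exp (σ * s) := by
    intro s hs hst
    have h1 : Real.exp (-(σ * s)) * |v s| ≤ M := hmax ⟨hs, hst⟩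
    have h2 := mul_le_mul_of_nonneg_right h1 (Real.exp_pos (σ * s)).le
    rwa [mul_right_comm, ← Real.exp_add, neg_add_cancel, Real.exp_zero, one_mul] at h2
  have h3 := abs_fracInt_le ha hσ0 hr.1 fun s hs hsr => hle s hs (hsr.trans hr.2)
  have h4 : |v r| ≤ 1 / 2 * (M * Real.exp (σ * r)) := by
    rw [h r hr.1, abs_neg, abs_mul, abs_of_pos hμ]
    calc μ * |fracInt a v r| ≤ μ * (σ ^ (-a) * (M * Real.exp (σ * r))) := by gcongr
      _ = μ * σ ^ (-a) * (M * Real.exp (σ * r)) := by ring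
      _ ≤ _ := by gcongr
  have h5 : |v r| = M * Real.exp (σ * r) := by
    rw [hM, mul_right_comm, ← Real.exp_add, neg_add_cancel, Real.exp_zero, one_mul]
  have h6 := hle t ht le_rfl
  have h7 : M * Real.exp (σ * r) ≤ 0 := by linarith
  have h8 : M ≤ 0 := nonpos_of_mul_nonpos_left h7 (Real.exp_pos _)
  rw [le_antisymm h8 hM0, zero_mul] at h6
  exact abs_nonpos_iff.1 h6

/-! ### The series along a chain of states -/

/-- Multi-indices `y` of total degree `i` on the set of states `{0} ∪ S` with `y j ≥ 1` for
`j ∈ S`. They are functions on `ℕ` that vanish off `{0} ∪ S`, so that the index sets of different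
`S` can be compared. -/
def chainIndex (S : Finset ℕ) (i : ℕ) : Finset (ℕ → ℕ) :=
  (Finset.piAntidiag (insert 0 S) i).filter fun y => ∀ j ∈ S, y j ≠ 0

/-- `t^b / Γ(1 + b) * ∏ μ_j^{y_j}` with `b = ∑ y_j a_j`, sum and product over the states in `A`. -/
noncomputable def chainMonomial (a μ : ℕ → ℝ) (A : Finset ℕ) (y : ℕ → ℕ) (t : ℝ) : ℝ :=
  t ^ (∑ j ∈ A, (y j : ℝ) * a j) / Real.Gamma (1 + ∑ j ∈ A, (y j : ℝ) * a j) *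
    ∏ j ∈ A, μ j ^ y j

/-- The part of total degree `i` of the series attached to the chain of states `{0} ∪ S`, up to
the sign `(-1)^i`. -/
noncomputable def chainTerm (a μ : ℕ → ℝ) (S : Finset ℕ) (i : ℕ) (t : ℝ) : ℝ :=
  ∑ y ∈ chainIndex S i, chainMonomial a μ (insert 0 S) y t

/-- The alternating sum of the `chainTerm`s. -/
noncomputable def chainSum (a μ : ℕ → ℝ) (S : Finset ℕ) (t : ℝ) : ℝ :=
  ∑' i : ℕ, (-1) ^ i * chainTerm a μ S i t

/-- The inverse Laplace transform of `s^{a_0 - 1} / ∏ (s^{a_j} + μ_j)`, product over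
`j ∈ {0} ∪ S`, as a series. -/
noncomputable def chainFun (a μ : ℕ → ℝ) (S : Finset ℕ) (t : ℝ) : ℝ :=
  (-1) ^ S.card / (∏ j ∈ S, μ j) * chainSum a μ S t

theorem mem_chainIndex {S : Finset ℕ} {i : ℕ} {y : ℕ → ℕ} :
    y ∈ chainIndex S i ↔ ((∑ j ∈ insert 0 S, y j = i) ∧ ∀ j, y j ≠ 0 → j ∈ insert 0 S) ∧
      ∀ j ∈ S, y j ≠ 0 := by
  simp only [chainIndex, Finset.mem_filter, Finset.mem_piAntidiag]

section Terms

variable {a μ : ℕ → ℝ}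

theorem sum_mul_nonneg (ha : ∀ j, 0 < a j) (A : Finset ℕ) (y : ℕ → ℕ) :
    0 ≤ ∑ j ∈ A, (y j : ℝ) * a j :=
  Finset.sum_nonneg fun j _ => mul_nonneg (Nat.cast_nonneg _) (ha j).le

theorem continuous_chainMonomial (ha : ∀ j, 0 < a j) (A : Finset ℕ) (y : ℕ → ℕ) :
    Continuous (chainMonomial a μ A y) := by
  unfold chainMonomial
  have := Real.continuous_rpow_const (sum_mul_nonneg ha A y)
  fun_prop

theorem continuous_chainTerm (ha : ∀ j, 0 < a j) (S : Finset ℕ) (i : ℕ) :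
    Continuous (chainTerm a μ S i) :=
  continuous_finsetSum _ fun y _ => continuous_chainMonomial ha _ y

/-- Fractional integration of order `a_j` raises the `j`-th exponent by one. -/
theorem chainMonomial_add_single (ha : ∀ j, 0 < a j) {A : Finset ℕ} {j : ℕ} (hj : j ∈ A)
    (y : ℕ → ℕ) {t : ℝ} (ht : 0 ≤ t) :
    chainMonomial a μ A (y + Pi.single j 1) t = μ j * fracInt (a j) (chainMonomial a μ A y) t := by
  have h1 : ∑ l ∈ A, ((y + Pi.single j 1 : ℕ → ℕ) l : ℝ) * a l =
      a j + ∑ l ∈ A, (y l : ℝ) * a l := by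
    simp only [Pi.add_apply, Nat.cast_add, add_mul, Finset.sum_add_distrib]
    rw [add_comm]
    congr 1
    rw [Finset.sum_eq_single_of_mem j hj]
    · simp
    · intro l _ hl
      simp [hl]
  have h2 : ∏ l ∈ A, μ l ^ (y + Pi.single j 1 : ℕ → ℕ) l = μ j * ∏ l ∈ A, μ l ^ y l := by
    simp only [Pi.add_apply, pow_add, Finset.prod_mul_distrib]
    rw [mul_comm]
    congr 1
    rw [Finset.prod_eq_single_of_mem j hj]
    · simp
    · intro l _ hl
      simp [hl]
  have h3 : fracInt (a j) (chainMonomial a μ A y) t = (∏ l ∈ A, μ l ^ y l) *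
      (t ^ (a j + ∑ l ∈ A, (y l : ℝ) * a l) /
        Real.Gamma (1 + (a j + ∑ l ∈ A, (y l : ℝ) * a l))) := by
    rw [← fracInt_rpow_div_Gamma (ha j) (sum_mul_nonneg ha A y) ht, ← fracInt_const_mul]
    congr 1
    funext s
    rw [chainMonomial, mul_comm]
  rw [h3, chainMonomial, h1, h2]
  ring

theorem chainMonomial_insert_of_eq_zero {A : Finset ℕ} {j : ℕ} {y : ℕ → ℕ} (hj : j ∉ A)
    (hy : y j = 0) : chainMonomial a μ (insert j A) y = chainMonomial a μ A y := by
  funext t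
  simp [chainMonomial, Finset.sum_insert hj, Finset.prod_insert hj, hy]

theorem sum_add_single {A : Finset ℕ} {j : ℕ} (hj : j ∈ A) (y : ℕ → ℕ) :
    ∑ l ∈ A, (y + Pi.single j 1 : ℕ → ℕ) l = ∑ l ∈ A, y l + 1 := by
  simp only [Pi.add_apply, Finset.sum_add_distrib]
  congr 1
  rw [Finset.sum_eq_single_of_mem j hj]
  · simp
  · intro l _ hl
    simp [hl]

theorem sub_single_add_single {j : ℕ} {y : ℕ → ℕ} (hy : y j ≠ 0) :
    y - Pi.single j 1 + Pi.single j 1 = y := by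
  funext l
  rcases eq_or_ne l j with rfl | hl
  · simp only [Pi.add_apply, Pi.sub_apply, Pi.single_eq_same]
    omega
  · simp [hl]

open Classical in
theorem chainIndex_empty_succ (i : ℕ) :
    chainIndex ∅ (i + 1) = (chainIndex ∅ i).image fun y => y + Pi.single 0 1 := by
  ext y
  simp only [Finset.mem_image]
  constructor
  · intro hy
    have h0 : y 0 ≠ 0 := by
      have := (mem_chainIndex.1 hy).1.1
      simp only [insert_empty_eq, Finset.sum_singleton] at this
      omega
    refine ⟨y - Pi.single 0 1, ?_, sub_single_add_single h0⟩
    rw [mem_chainIndex] at hy ⊢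
    have h1 := sum_add_single (Finset.mem_insert_self 0 ∅) (y - Pi.single 0 1)
    rw [sub_single_add_single h0, hy.1.1] at h1
    refine ⟨⟨by omega, fun j hj => hy.1.2 j fun h => hj ?_⟩, by simp⟩
    simp [h]
  · rintro ⟨y, hy, rfl⟩
    rw [mem_chainIndex] at hy ⊢
    refine ⟨⟨?_, fun j hj => ?_⟩, by simp⟩
    · rw [sum_add_single (Finset.mem_insert_self 0 ∅), hy.1.1]
    · by_contra h
      have hj0 : j ≠ 0 := fun h0 => h (by simp [h0])
      simp only [Pi.add_apply, Pi.single_eq_of_ne hj0, add_zero] at hj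
      exact h (hy.1.2 j hj)

open Classical in
theorem chainIndex_insert_succ {S : Finset ℕ} {j : ℕ} (hj : j ∉ insert 0 S) (i : ℕ) :
    chainIndex (insert j S) (i + 1) =
      (chainIndex S i ∪ chainIndex (insert j S) i).image fun y => y + Pi.single j 1 := by
  have hS : insert 0 (insert j S) = insert j (insert 0 S) := Finset.insert_comm _ _ _
  have hjm : j ∈ insert 0 (insert j S) := by simp
  ext y
  simp only [Finset.mem_image, Finset.mem_union]
  constructor
  · intro hy
    have h0 : y j ≠ 0 := (mem_chainIndex.1 hy).2 j (Finset.mem_insert_self _ _)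
    refine ⟨y - Pi.single j 1, ?_, sub_single_add_single h0⟩
    rw [mem_chainIndex] at hy
    have h1 := sum_add_single hjm (y - Pi.single j 1)
    rw [sub_single_add_single h0, hy.1.1] at h1
    have hne : ∀ l, l ≠ j → (y - Pi.single j 1 : ℕ → ℕ) l = y l := fun l hl => by simp [hl]
    by_cases hz : (y - Pi.single j 1 : ℕ → ℕ) j = 0
    · left
      rw [mem_chainIndex]
      rw [hS, Finset.sum_insert hj, hz, zero_add] at h1
      refine ⟨⟨by omega, fun l hl => ?_⟩, fun l hl => ?_⟩
      · have hlj : l ≠ j := fun h => hl (h ▸ hz)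
        rw [hne l hlj] at hl
        have := hy.1.2 l hl
        rw [hS, Finset.mem_insert] at this
        exact this.resolve_left hlj
      · have hlj : l ≠ j := fun h => hj (h ▸ Finset.mem_insert_of_mem hl)
        rw [hne l hlj]
        exact hy.2 l (Finset.mem_insert_of_mem hl)
    · right
      rw [mem_chainIndex]
      refine ⟨⟨by omega, fun l hl => hy.1.2 l fun h => hl ?_⟩, fun l hl => ?_⟩
      · simp [h]
      · rcases eq_or_ne l j with rfl | hlj
        · exact hz
        · rw [hne l hlj]
          exact hy.2 l hl
  · rintro ⟨y, hy, rfl⟩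
    have hge : ∀ l, y l ≠ 0 → (y + Pi.single j 1 : ℕ → ℕ) l ≠ 0 := fun l hl => by
      simp only [Pi.add_apply]
      omega
    have hjj : (y + Pi.single j 1 : ℕ → ℕ) j ≠ 0 := by simp
    have hsupp : (∀ l, y l ≠ 0 → l ∈ insert 0 (insert j S)) →
        ∀ l, (y + Pi.single j 1 : ℕ → ℕ) l ≠ 0 → l ∈ insert 0 (insert j S) := by
      intro h l hl
      rcases eq_or_ne l j with rfl | hlj
      · exact hjm
      · simp only [Pi.add_apply, Pi.single_eq_of_ne hlj, add_zero] at hl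
        exact h l hl
    rw [mem_chainIndex, sum_add_single hjm]
    rcases hy with hy | hy
    · rw [mem_chainIndex] at hy
      have hyj : y j = 0 := by
        by_contra h
        exact hj (hy.1.2 j h)
      refine ⟨⟨?_, hsupp fun l hl => ?_⟩, fun l hl => ?_⟩
      · rw [hS, Finset.sum_insert hj, hyj, hy.1.1, zero_add]
      · rw [hS]
        exact Finset.mem_insert_of_mem (hy.1.2 l hl)
      · rcases Finset.mem_insert.1 hl with rfl | hl
        · exact hjj
        · exact hge l (hy.2 l hl)
    · rw [mem_chainIndex] at hy
      exact ⟨⟨by rw [hy.1.1], hsupp hy.1.2⟩, fun l hl => hge l (hy.2 l hl)⟩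

theorem chainTerm_empty_zero (t : ℝ) : chainTerm a μ ∅ 0 t = 1 := by
  have : chainIndex ∅ 0 = {0} := by
    simp [chainIndex]
  rw [chainTerm, this]
  simp [chainMonomial]

theorem chainTerm_eq_zero_of_lt {S : Finset ℕ} {i : ℕ} (h : i < S.card) (t : ℝ) :
    chainTerm a μ S i t = 0 := by
  have : chainIndex S i = ∅ := by
    rw [Finset.eq_empty_iff_forall_notMem]
    intro y hy
    rw [mem_chainIndex] at hy
    have h1 : S.card ≤ ∑ j ∈ insert 0 S, y j := by
      calc S.card = ∑ j ∈ S, 1 := by simp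
        _ ≤ ∑ j ∈ S, y j := Finset.sum_le_sum fun j hj => Nat.one_le_iff_ne_zero.2 (hy.2 j hj)
        _ ≤ _ := Finset.sum_le_sum_of_subset (Finset.subset_insert _ _)
    omega
  rw [chainTerm, this, Finset.sum_empty]

theorem chainTerm_empty_succ (ha : ∀ j, 0 < a j) (i : ℕ) {t : ℝ} (ht : 0 ≤ t) :
    chainTerm a μ ∅ (i + 1) t = μ 0 * fracInt (a 0) (chainTerm a μ ∅ i) t := by
  classical
  have h1 : fracInt (a 0) (chainTerm a μ ∅ i) t =
      ∑ y ∈ chainIndex ∅ i, fracInt (a 0) (chainMonomial a μ (insert 0 ∅) y) t :=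
    fracInt_finset_sum (ha 0) ht _ fun y _ => (continuous_chainMonomial ha _ y).continuousOn
  rw [h1, Finset.mul_sum, chainTerm, chainIndex_empty_succ, Finset.sum_image]
  · exact Finset.sum_congr rfl fun y _ =>
      chainMonomial_add_single ha (Finset.mem_insert_self 0 ∅) y ht
  · exact fun y _ z _ h => add_right_cancel h

/-- Either the `j`-th exponent is one, and removing it leaves a multi-index for `S`, or it can be
lowered by one within the multi-indices for `insert j S`. -/
theorem chainTerm_insert_succ (ha : ∀ j, 0 < a j) {S : Finset ℕ} {j : ℕ} (hj : j ∉ insert 0 S)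
    (i : ℕ) {t : ℝ} (ht : 0 ≤ t) :
    chainTerm a μ (insert j S) (i + 1) t =
      μ j * fracInt (a j) (fun s => chainTerm a μ S i s + chainTerm a μ (insert j S) i s) t := by
  classical
  have hS : insert 0 (insert j S) = insert j (insert 0 S) := Finset.insert_comm _ _ _
  have hjm : j ∈ insert 0 (insert j S) := by simp
  have hzero : ∀ y ∈ chainIndex S i, y j = 0 := fun y hy => by
    by_contra h
    exact hj ((mem_chainIndex.1 hy).1.2 j h)
  have hdisj : Disjoint (chainIndex S i) (chainIndex (insert j S) i) := by
    rw [Finset.disjoint_left]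
    intro y hy hy'
    exact (mem_chainIndex.1 hy').2 j (Finset.mem_insert_self _ _) (hzero y hy)
  have h1 : ∀ s, chainTerm a μ S i s + chainTerm a μ (insert j S) i s =
      ∑ y ∈ chainIndex S i ∪ chainIndex (insert j S) i,
        chainMonomial a μ (insert 0 (insert j S)) y s := by
    intro s
    rw [Finset.sum_union hdisj, chainTerm, chainTerm]
    congr 1
    refine Finset.sum_congr rfl fun y hy => ?_
    rw [hS, chainMonomial_insert_of_eq_zero hj (hzero y hy)]
  simp only [h1]
  rw [fracInt_finset_sum (ha j) ht _
      fun y _ => (continuous_chainMonomial ha _ y).continuousOn,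
    Finset.mul_sum, chainTerm, chainIndex_insert_succ hj, Finset.sum_image]
  · exact Finset.sum_congr rfl fun y _ => chainMonomial_add_single ha hjm y ht
  · exact fun y _ z _ h => add_right_cancel h

/-- For `σ` so large that each `μ_j σ^{-a_j}` is at most `1/4`, the norm `sup e^{-σt} |f t|` of the
term of degree `i` is at most `2^{-i}`. -/
theorem abs_chainTerm_le (ha : ∀ j, 0 < a j) (hμ : ∀ j, 0 < μ j) {σ : ℝ} (hσ : 0 < σ)
    (S : Finset ℕ) (h0 : 0 ∉ S) (hS : ∀ j ∈ insert 0 S, μ j * σ ^ (-a j) ≤ 1 / 4) (i : ℕ) (t : ℝ)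
    (ht : 0 ≤ t) : |chainTerm a μ S i t| ≤ (1 / 2) ^ i * Real.exp (σ * t) := by
  induction S using Finset.induction_on generalizing i t with
  | empty =>
    induction i generalizing t with
    | zero =>
      rw [chainTerm_empty_zero, abs_one, pow_zero, one_mul]
      exact Real.one_le_exp (by positivity)
    | succ i ih =>
      have h1 := abs_fracInt_le (ha 0) hσ ht fun s hs _ => ih s hs
      rw [chainTerm_empty_succ ha i ht, abs_mul, abs_of_pos (hμ 0)]
      calc μ 0 * |fracInt (a 0) (chainTerm a μ ∅ i) t|
          ≤ μ 0 * (σ ^ (-a 0) * ((1 / 2) ^ i * Real.exp (σ * t))) :=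
            mul_le_mul_of_nonneg_left h1 (hμ 0).le
        _ = μ 0 * σ ^ (-a 0) * ((1 / 2) ^ i * Real.exp (σ * t)) := by ring
        _ ≤ 1 / 4 * ((1 / 2) ^ i * Real.exp (σ * t)) := by
            gcongr
            exact hS 0 (Finset.mem_insert_self _ _)
        _ ≤ 1 / 2 * ((1 / 2) ^ i * Real.exp (σ * t)) := by gcongr; norm_num
        _ = _ := by rw [pow_succ]; ring
  | insert j S hjS ihS =>
    have h0S : 0 ∉ S := fun h => h0 (Finset.mem_insert_of_mem h)
    have hj0 : j ∉ insert 0 S := by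
      rw [Finset.mem_insert, not_or]
      exact ⟨fun h => h0 (h ▸ Finset.mem_insert_self _ _), hjS⟩
    have ihS' := ihS h0S fun l hl => hS l (by
      rw [Finset.insert_comm]
      exact Finset.mem_insert_of_mem hl)
    induction i generalizing t with
    | zero =>
      rw [chainTerm_eq_zero_of_lt (by rw [Finset.card_insert_of_notMem hjS]; omega), abs_zero]
      positivity
    | succ i ih =>
      have hb : ∀ s, 0 ≤ s → s ≤ t → |chainTerm a μ S i s + chainTerm a μ (insert j S) i s| ≤
          2 * (1 / 2) ^ i * Real.exp (σ * s) := fun s hs _ => by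
        have h1 := abs_add_le (chainTerm a μ S i s) (chainTerm a μ (insert j S) i s)
        have h2 := ihS' i s hs
        have h3 := ih s hs
        linarith
      have h1 := abs_fracInt_le (ha j) hσ ht hb
      rw [chainTerm_insert_succ ha hj0 i ht, abs_mul, abs_of_pos (hμ j)]
      calc μ j * |fracInt (a j) (fun s => chainTerm a μ S i s + chainTerm a μ (insert j S) i s) t|
          ≤ μ j * (σ ^ (-a j) * (2 * (1 / 2) ^ i * Real.exp (σ * t))) :=
            mul_le_mul_of_nonneg_left h1 (hμ j).le
        _ = μ j * σ ^ (-a j) * (2 * (1 / 2) ^ i * Real.exp (σ * t)) := by ring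
        _ ≤ 1 / 4 * (2 * (1 / 2) ^ i * Real.exp (σ * t)) := by
            gcongr
            exact hS j (by simp)
        _ = _ := by rw [pow_succ]; ring

theorem exists_abs_chainTerm_le (ha : ∀ j, 0 < a j) (hμ : ∀ j, 0 < μ j) (S : Finset ℕ)
    (h0 : 0 ∉ S) : ∃ σ : ℝ, 0 < σ ∧ ∀ i t, 0 ≤ t →
      |chainTerm a μ S i t| ≤ (1 / 2) ^ i * Real.exp (σ * t) := by
  have h1 : ∀ᶠ σ : ℝ in Filter.atTop, ∀ j ∈ insert 0 S, μ j * σ ^ (-a j) ≤ 1 / 4 :=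
    (Filter.eventually_all_finset _).2 fun j _ =>
      eventually_mul_rpow_neg_le (ha j) (by norm_num) (μ j)
  obtain ⟨σ, hσ, hσ0⟩ := (h1.and (Filter.eventually_gt_atTop 0)).exists
  exact ⟨σ, hσ0, fun i t ht => abs_chainTerm_le ha hμ hσ0 S h0 hσ i t ht⟩

theorem abs_neg_one_pow_mul (i : ℕ) (x : ℝ) : |(-1) ^ i * x| = |x| := by
  rw [abs_mul, abs_pow, abs_neg, abs_one, one_pow, one_mul]

theorem summable_chainTerm (ha : ∀ j, 0 < a j) (hμ : ∀ j, 0 < μ j) {S : Finset ℕ} (h0 : 0 ∉ S)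
    {t : ℝ} (ht : 0 ≤ t) : Summable fun i => (-1) ^ i * chainTerm a μ S i t := by
  obtain ⟨σ, _, hσ⟩ := exists_abs_chainTerm_le ha hμ S h0
  refine Summable.of_norm_bounded (summable_geometric_two.mul_right (Real.exp (σ * t))) fun i => ?_
  rw [Real.norm_eq_abs, abs_neg_one_pow_mul]
  exact hσ i t ht

theorem continuousOn_chainSum (ha : ∀ j, 0 < a j) (hμ : ∀ j, 0 < μ j) {S : Finset ℕ}
    (h0 : 0 ∉ S) : ContinuousOn (chainSum a μ S) (Ici 0) := by
  obtain ⟨σ, hσ0, hσ⟩ := exists_abs_chainTerm_le ha hμ S h0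
  have hT : ∀ T, ContinuousOn (chainSum a μ S) (Icc 0 T) := by
    intro T
    apply continuousOn_tsum (u := fun i => (1 / 2) ^ i * Real.exp (σ * T))
    · exact fun i => ((continuous_chainTerm ha S i).const_mul _).continuousOn
    · exact summable_geometric_two.mul_right _
    · intro i t ht
      rw [Real.norm_eq_abs, abs_neg_one_pow_mul]
      refine (hσ i t ht.1).trans ?_
      have := ht.2
      gcongr
  intro t ht
  refine (hT (t + 1) t ⟨ht, by linarith⟩).mono_of_mem_nhdsWithin ?_
  rw [← Ici_inter_Iic]
  exact inter_mem_nhdsWithin _ (Iic_mem_nhds (by linarith))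

theorem chainSum_empty (ha : ∀ j, 0 < a j) (hμ : ∀ j, 0 < μ j) {t : ℝ} (ht : 0 ≤ t) :
    chainSum a μ ∅ t = 1 - μ 0 * fracInt (a 0) (chainSum a μ ∅) t := by
  obtain ⟨σ, hσ0, hσ⟩ := exists_abs_chainTerm_le ha hμ ∅ (Finset.notMem_empty 0)
  have h1 : HasSum (fun i => fracInt (a 0) (fun s => (-1) ^ i * chainTerm a μ ∅ i s) t)
      (fracInt (a 0) (chainSum a μ ∅) t) := by
    apply hasSum_fracInt (ha 0) ht summable_geometric_two (σ := σ)
    · exact fun i => ((continuous_chainTerm ha ∅ i).const_mul _).continuousOn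
    · intro i s hs
      rw [abs_neg_one_pow_mul]
      exact hσ i s hs
    · exact fun s hs => (summable_chainTerm ha hμ (Finset.notMem_empty 0) hs).hasSum
  rw [chainSum, (summable_chainTerm ha hμ (Finset.notMem_empty 0) ht).tsum_eq_zero_add,
    chainTerm_empty_zero, sub_eq_add_neg, ← h1.tsum_eq, ← tsum_mul_left, ← tsum_neg]
  congr 1
  · simp
  · refine tsum_congr fun i => ?_
    rw [chainTerm_empty_succ ha i ht, fracInt_const_mul, pow_succ]
    ring

theorem chainSum_insert (ha : ∀ j, 0 < a j) (hμ : ∀ j, 0 < μ j) {S : Finset ℕ} {j : ℕ}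
    (h0 : 0 ∉ insert j S) (hjS : j ∉ S) {t : ℝ} (ht : 0 ≤ t) :
    chainSum a μ (insert j S) t =
      -(μ j * fracInt (a j) (fun s => chainSum a μ S s + chainSum a μ (insert j S) s) t) := by
  have h0S : 0 ∉ S := fun h => h0 (Finset.mem_insert_of_mem h)
  have hj0 : j ∉ insert 0 S := by
    rw [Finset.mem_insert, not_or]
    exact ⟨fun h => h0 (h ▸ Finset.mem_insert_self _ _), hjS⟩
  obtain ⟨σ, hσ0, hσ⟩ := exists_abs_chainTerm_le ha hμ (insert j S) h0
  obtain ⟨σ', hσ0', hσ'⟩ := exists_abs_chainTerm_le ha hμ S h0S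
  have h1 : HasSum (fun i => fracInt (a j)
      (fun s => (-1) ^ i * (chainTerm a μ S i s + chainTerm a μ (insert j S) i s)) t)
      (fracInt (a j) (fun s => chainSum a μ S s + chainSum a μ (insert j S) s) t) := by
    apply hasSum_fracInt (ha j) ht (u := fun i => 2 * (1 / 2) ^ i)
      (summable_geometric_two.mul_left 2) (σ := max σ σ')
    · exact fun i => (((continuous_chainTerm ha S i).add
        (continuous_chainTerm ha (insert j S) i)).const_mul _).continuousOn
    · intro i s hs
      rw [abs_neg_one_pow_mul]
      have h2 := abs_add_le (chainTerm a μ S i s) (chainTerm a μ (insert j S) i s)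
      have h3 : (1 / 2 : ℝ) ^ i * Real.exp (σ * s) ≤ (1 / 2) ^ i * Real.exp (max σ σ' * s) := by
        gcongr
        exact le_max_left _ _
      have h4 : (1 / 2 : ℝ) ^ i * Real.exp (σ' * s) ≤ (1 / 2) ^ i * Real.exp (max σ σ' * s) := by
        gcongr
        exact le_max_right _ _
      have h5 := hσ i s hs
      have h6 := hσ' i s hs
      linarith
    · intro s hs
      simp only [mul_add]
      exact (summable_chainTerm ha hμ h0S hs).hasSum.add (summable_chainTerm ha hμ h0 hs).hasSum
  rw [chainSum, (summable_chainTerm ha hμ h0 ht).tsum_eq_zero_add,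
    chainTerm_eq_zero_of_lt (by rw [Finset.card_insert_of_notMem hjS]; omega), mul_zero, zero_add,
    ← h1.tsum_eq, ← tsum_mul_left, ← tsum_neg]
  refine tsum_congr fun i => ?_
  rw [chainTerm_insert_succ ha hj0 i ht, fracInt_const_mul, pow_succ]
  ring

end Terms

section Transform

variable {a μ : ℕ → ℝ}

theorem continuousOn_chainFun (ha : ∀ j, 0 < a j) (hμ : ∀ j, 0 < μ j) {S : Finset ℕ}
    (h0 : 0 ∉ S) : ContinuousOn (chainFun a μ S) (Ici 0) :=
  continuousOn_const.mul (continuousOn_chainSum ha hμ h0)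

theorem chainFun_empty (ha : ∀ j, 0 < a j) (hμ : ∀ j, 0 < μ j) {t : ℝ} (ht : 0 ≤ t) :
    chainFun a μ ∅ t = 1 - μ 0 * fracInt (a 0) (chainFun a μ ∅) t := by
  have h1 : chainFun a μ ∅ = chainSum a μ ∅ := by
    funext s
    simp [chainFun]
  rw [h1]
  exact chainSum_empty ha hμ ht

/-- The chain function of `insert j S` solves the relaxation equation of order `a_j` and rate
`μ_j` that is driven by the chain function of `S`. -/
theorem chainFun_insert (ha : ∀ j, 0 < a j) (hμ : ∀ j, 0 < μ j) {S : Finset ℕ} {j : ℕ}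
    (h0 : 0 ∉ insert j S) (hjS : j ∉ S) {t : ℝ} (ht : 0 ≤ t) :
    chainFun a μ (insert j S) t =
      fracInt (a j) (fun s => chainFun a μ S s - μ j * chainFun a μ (insert j S) s) t := by
  have hp : ∏ l ∈ S, μ l ≠ 0 := Finset.prod_ne_zero_iff.2 fun l _ => (hμ l).ne'
  have hj := (hμ j).ne'
  have h1 : ∀ s, chainFun a μ S s - μ j * chainFun a μ (insert j S) s =
      (-1) ^ S.card / (∏ l ∈ S, μ l) * (chainSum a μ S s + chainSum a μ (insert j S) s) := by
    intro s
    rw [chainFun, chainFun, Finset.card_insert_of_notMem hjS, Finset.prod_insert hjS, pow_succ]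
    field_simp
    ring
  simp only [h1]
  rw [fracInt_const_mul, chainFun, chainSum_insert ha hμ h0 hjS ht,
    Finset.card_insert_of_notMem hjS, Finset.prod_insert hjS, pow_succ]
  field_simp

theorem integrableOn_exp_mul_chainFun_sq (ha : ∀ j, 0 < a j) (ha1 : ∀ j, a j ≤ 1)
    (hμ : ∀ j, 0 < μ j) {S : Finset ℕ} (h0 : 0 ∉ S) {c : ℝ} (hc : 0 < c) :
    IntegrableOn (fun t => Real.exp (-(c * t)) * chainFun a μ S t ^ 2) (Ioi 0) := by
  induction S using Finset.induction_on with
  | empty =>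
    have hu := continuousOn_chainFun ha hμ h0
    have hv : ContinuousOn (fun t => 1 - chainFun a μ ∅ t) (Ici 0) := continuousOn_const.sub hu
    have he := (integral_Ioi_exp_neg_mul hc).1
    have h1 : IntegrableOn (fun t => Real.exp (-(c * t)) * (1 - chainFun a μ ∅ t) ^ 2)
        (Ioi 0) := by
      apply integrableOn_exp_mul_sq_of_relaxation (ha 0) (ha1 0) (hμ 0) hv
        (g := fun _ => μ 0) continuousOn_const _ hc (he.mul_const _)
      intro t ht
      have h2 : ∀ s, μ 0 - μ 0 * (1 - chainFun a μ ∅ s) = μ 0 * chainFun a μ ∅ s :=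
        fun s => by ring
      simp only [h2]
      rw [fracInt_const_mul, chainFun_empty ha hμ ht]
      ring
    have h2 := integrableOn_exp_mul_of_sq hv hc h1
    refine ((he.sub (h2.const_mul 2)).add h1).congr (Filter.Eventually.of_forall fun t => ?_)
    simp only [Pi.add_apply, Pi.sub_apply]
    ring
  | insert j S hjS ih =>
    have h0S : 0 ∉ S := fun h => h0 (Finset.mem_insert_of_mem h)
    exact integrableOn_exp_mul_sq_of_relaxation (ha j) (ha1 j) (hμ j)
      (continuousOn_chainFun ha hμ h0) (continuousOn_chainFun ha hμ h0S)
      (fun t ht => chainFun_insert ha hμ h0 hjS ht) hc (ih h0S)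

theorem laplace_chainFun (ha : ∀ j, 0 < a j) (ha1 : ∀ j, a j ≤ 1)
    (hμ : ∀ j, 0 < μ j) {S : Finset ℕ} (h0 : 0 ∉ S) {s : ℝ} (hs : 0 < s) :
    ∫ t in Ioi (0 : ℝ), Real.exp (-(s * t)) * chainFun a μ S t =
      s ^ (a 0 - 1) / ∏ j ∈ insert 0 S, (s ^ a j + μ j) := by
  have hi : ∀ {S : Finset ℕ}, 0 ∉ S →
      IntegrableOn (fun t => Real.exp (-(s * t)) * chainFun a μ S t) (Ioi 0) := fun h0 =>
    integrableOn_exp_mul_of_sq (continuousOn_chainFun ha hμ h0) hs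
      (integrableOn_exp_mul_chainFun_sq ha ha1 hμ h0 hs)
  induction S using Finset.induction_on with
  | empty =>
    obtain ⟨he, he1⟩ := integral_Ioi_exp_neg_mul hs
    have h1 : ∀ t, Real.exp (-(s * t)) * (1 - chainFun a μ ∅ t) =
        Real.exp (-(s * t)) - Real.exp (-(s * t)) * chainFun a μ ∅ t := fun t => by ring
    have hv : IntegrableOn (fun t => Real.exp (-(s * t)) * (1 - chainFun a μ ∅ t)) (Ioi 0) := by
      simp only [h1]
      exact he.sub (hi h0)
    have h2 := laplace_relaxation (ha 0) (hμ 0) hs (u := fun t => 1 - chainFun a μ ∅ t)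
      (g := fun _ => μ 0) ?_ (he.mul_const _) hv
    · simp only [h1] at h2
      rw [integral_sub he (hi h0), integral_mul_const, he1] at h2
      have h3 : 0 < s ^ a 0 := Real.rpow_pos_of_pos hs _
      have h4 := hμ 0
      rw [insert_empty_eq, Finset.prod_singleton, Real.rpow_sub_one hs.ne']
      have h5 : ∫ t in Ioi (0 : ℝ), Real.exp (-(s * t)) * chainFun a μ ∅ t =
          1 / s - 1 / s * μ 0 / (s ^ a 0 + μ 0) := by linarith
      rw [h5]
      field_simp
      ring
    · intro t ht
      have h2 : ∀ s, μ 0 - μ 0 * (1 - chainFun a μ ∅ s) = μ 0 * chainFun a μ ∅ s :=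
        fun s => by ring
      simp only [h2]
      rw [fracInt_const_mul, chainFun_empty ha hμ ht]
      ring
  | insert j S hjS ih =>
    have h0S : 0 ∉ S := fun h => h0 (Finset.mem_insert_of_mem h)
    have hj0 : j ∉ insert 0 S := by
      rw [Finset.mem_insert, not_or]
      exact ⟨fun h => h0 (h ▸ Finset.mem_insert_self _ _), hjS⟩
    rw [laplace_relaxation (ha j) (hμ j) hs (fun t ht => chainFun_insert ha hμ h0 hjS ht) (hi h0S)
      (hi h0), ih h0S, Finset.insert_comm, Finset.prod_insert hj0, div_div]
    congr 1
    ring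

theorem isInverseLaplace_chainFun (ha : ∀ j, 0 < a j) (ha1 : ∀ j, a j ≤ 1)
    (hμ : ∀ j, 0 < μ j) {S : Finset ℕ} (h0 : 0 ∉ S) :
    IsInverseLaplace (fun s => s ^ (a 0 - 1) / ∏ j ∈ insert 0 S, (s ^ a j + μ j))
      (chainFun a μ S) :=
  ⟨continuousOn_chainFun ha hμ h0, fun _ hs =>
    ⟨integrableOn_exp_mul_of_sq (continuousOn_chainFun ha hμ h0) hs
      (integrableOn_exp_mul_chainFun_sq ha ha1 hμ h0 hs), laplace_chainFun ha ha1 hμ h0 hs⟩⟩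

end Transform

/-! ### Paths of the process -/

/-- The paths with jumps in `{1, …, k}` that lead from the state `0` to the state `m`, as the
sequences of `Theta m k`. In contrast to `Theta`, the empty path is included for `m = 0`. -/
noncomputable def pathSet (k m : ℕ) : Finset (ℕ →₀ ℕ) := if m = 0 then {0} else Theta m k

/-- The states other than `0` that the path `x` to `m` visits. -/
noncomputable def visited (m : ℕ) (x : ℕ →₀ ℕ) : Finset ℕ := (Lam m x).erase 0

theorem pathSet_zero (k : ℕ) : pathSet k 0 = {0} := if_pos rfl

theorem pathSet_of_pos {m : ℕ} (k : ℕ) (hm : 1 ≤ m) : pathSet k m = Theta m k :=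
  if_neg (by omega)

/-- A path to `m` has no jumps longer than `m`. -/
theorem Theta_eq_of_le {m k l : ℕ} (hk : m ≤ k) (hl : m ≤ l) : Theta m k = Theta m l := by
  match m with
  | 0 => rw [Theta, Theta]
  | 1 => rw [Theta, Theta]
  | n + 2 => rw [Theta, Theta, if_neg (by omega), if_neg (by omega)]

/-- Decomposition of a path according to its last jump. -/
theorem mem_Theta_iff {m k : ℕ} (hm : 1 ≤ m) (hk : 1 ≤ k) {x : ℕ →₀ ℕ} :
    x ∈ Theta m k ↔ ∃ i ∈ Finset.Icc 1 (min m k), ∃ y ∈ pathSet k (m - i),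
      y + Finsupp.single (m - i + 1) i = x := by
  match m, hm with
  | 1, _ =>
    rw [Theta, Finset.mem_singleton, min_eq_left hk]
    constructor
    · rintro rfl
      exact ⟨1, by simp, 0, by simp [pathSet_zero], by simp⟩
    · rintro ⟨i, hi, y, hy, rfl⟩
      obtain rfl : i = 1 := by
        rw [Finset.mem_Icc] at hi
        omega
      rw [Nat.sub_self, pathSet_zero, Finset.mem_singleton] at hy
      simp [hy]
  | n + 2, _ =>
    rw [Theta]
    split_ifs with h
    · rw [min_eq_right (by omega)]
      simp only [Finset.mem_biUnion, Finset.mem_range, Finset.mem_image, Finset.mem_Icc]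
      constructor
      · rintro ⟨r, hr, y, hy, rfl⟩
        exact ⟨r + 1, by omega, y, by rwa [pathSet_of_pos k (by omega)], rfl⟩
      · rintro ⟨i, hi, y, hy, rfl⟩
        obtain ⟨r, rfl⟩ : ∃ r, i = r + 1 := ⟨i - 1, by omega⟩
        exact ⟨r, by omega, y, by rwa [pathSet_of_pos k (by omega)] at hy, rfl⟩
    · rw [min_eq_left (by omega)]
      simp only [Finset.mem_union, Finset.mem_biUnion, Finset.mem_range, Finset.mem_image,
        Finset.mem_Icc, Finset.mem_singleton]
      constructor
      · rintro (⟨r, hr, y, hy, rfl⟩ | rfl)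
        · refine ⟨r + 1, by omega, y, ?_, rfl⟩
          rwa [pathSet_of_pos k (by omega), Theta_eq_of_le (l := n + 2) (by omega) (by omega)]
        · exact ⟨n + 2, by omega, 0, by simp [pathSet_zero], by simp⟩
      · rintro ⟨i, hi, y, hy, rfl⟩
        by_cases hin : i = n + 2
        · right
          subst hin
          rw [Nat.sub_self, pathSet_zero, Finset.mem_singleton] at hy
          simp [hy]
        · left
          obtain ⟨r, rfl⟩ : ∃ r, i = r + 1 := ⟨i - 1, by omega⟩
          refine ⟨r, by omega, y, ?_, rfl⟩
          rwa [pathSet_of_pos k (by omega), Theta_eq_of_le (l := n + 2) (by omega) (by omega)]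
            at hy

theorem apply_eq_zero_of_mem_pathSet {k : ℕ} (hk : 1 ≤ k) {m : ℕ} {x : ℕ →₀ ℕ}
    (hx : x ∈ pathSet k m) {j : ℕ} (hj : m < j) : x j = 0 := by
  induction m using Nat.strong_induction_on generalizing x with
  | _ m ih =>
    rcases Nat.eq_zero_or_pos m with rfl | hm
    · rw [pathSet_zero, Finset.mem_singleton] at hx
      simp [hx]
    · rw [pathSet_of_pos k hm, mem_Theta_iff hm hk] at hx
      obtain ⟨i, hi, y, hy, rfl⟩ := hx
      rw [Finset.mem_Icc] at hi
      rw [Finsupp.add_apply, ih (m - i) (by omega) hy (by omega), Finsupp.single_apply,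
        if_neg (by omega), add_zero]

theorem sum_pathSet {k : ℕ} (hk : 1 ≤ k) {m : ℕ} (hm : 1 ≤ m) (F : (ℕ →₀ ℕ) → ℝ) :
    ∑ x ∈ pathSet k m, F x = ∑ i ∈ Finset.Icc 1 (min m k), ∑ y ∈ pathSet k (m - i),
      F (y + Finsupp.single (m - i + 1) i) := by
  have h1 : pathSet k m = (Finset.Icc 1 (min m k)).biUnion fun i =>
      (pathSet k (m - i)).image fun y => y + Finsupp.single (m - i + 1) i := by
    ext x
    rw [pathSet_of_pos k hm, mem_Theta_iff hm hk]
    simp only [Finset.mem_biUnion, Finset.mem_image]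
  rw [h1, Finset.sum_biUnion]
  · refine Finset.sum_congr rfl fun i _ => ?_
    rw [Finset.sum_image]
    exact fun y _ z _ h => add_right_cancel h
  · -- the position of the last nonzero entry determines the last jump
    have hlt : ∀ i j : ℕ, 1 ≤ i → i < j → j ≤ m → ∀ y ∈ pathSet k (m - i),
        ∀ z ∈ pathSet k (m - j),
          y + Finsupp.single (m - i + 1) i ≠ z + Finsupp.single (m - j + 1) j := by
      intro i j hi hij hjm y hy z hz h
      have h2 := DFunLike.congr_fun h (m - i + 1)
      rw [Finsupp.add_apply, Finsupp.add_apply, Finsupp.single_eq_same, Finsupp.single_apply,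
        if_neg (by omega), apply_eq_zero_of_mem_pathSet hk hz (by omega)] at h2
      omega
    intro i hi j hj hij
    rw [Finset.mem_coe, Finset.mem_Icc] at hi hj
    rw [Function.onFun, Finset.disjoint_left]
    intro x hx hx'
    obtain ⟨y, hy, rfl⟩ := Finset.mem_image.1 hx
    obtain ⟨z, hz, h⟩ := Finset.mem_image.1 hx'
    rcases lt_or_gt_of_ne hij with hij | hij
    · exact hlt i j hi.1 hij (by omega) y hy z hz h.symm
    · exact hlt j i hj.1 hij (by omega) z hz y hy h

theorem mem_Lam {m j : ℕ} {x : ℕ →₀ ℕ} :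
    j ∈ Lam m x ↔ j ≤ m ∧ ¬((1 ≤ j ∧ j ≤ m - 1) ∧ x (j + 1) = 0) := by
  simp only [Lam, Finset.mem_sdiff, Finset.mem_range, Finset.mem_filter, Finset.mem_Icc,
    Nat.lt_succ_iff]

theorem zero_mem_Lam (m : ℕ) (x : ℕ →₀ ℕ) : 0 ∈ Lam m x := by
  rw [mem_Lam]
  omega

theorem insert_zero_visited (m : ℕ) (x : ℕ →₀ ℕ) : insert 0 (visited m x) = Lam m x :=
  Finset.insert_erase (zero_mem_Lam m x)

theorem zero_notMem_visited (m : ℕ) (x : ℕ →₀ ℕ) : 0 ∉ visited m x := Finset.notMem_erase _ _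

theorem visited_zero (x : ℕ →₀ ℕ) : visited 0 x = ∅ := by
  ext j
  simp only [visited, Finset.mem_erase, mem_Lam, Finset.notMem_empty, iff_false]
  omega

theorem notMem_visited {p m : ℕ} (h : p < m) (x : ℕ →₀ ℕ) : m ∉ visited p x := by
  simp only [visited, Finset.mem_erase, mem_Lam]
  omega

theorem visited_add_single {p i : ℕ} (hi : 1 ≤ i) {y : ℕ →₀ ℕ} (hy : ∀ j, p < j → y j = 0) :
    visited (p + i) (y + Finsupp.single (p + 1) i) = insert (p + i) (visited p y) := by
  ext j
  simp only [visited, Finset.mem_erase, mem_Lam, Finset.mem_insert, Finsupp.add_apply,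
    Finsupp.single_apply]
  rcases lt_trichotomy j p with h | h | h
  · rw [if_neg (by omega)]
    omega
  · subst h
    rw [if_pos rfl]
    omega
  · rw [if_neg (by omega), hy (j + 1) (by omega)]
    omega

theorem prod_rate_add_single (lam : ℕ → ℕ → ℝ) (n₀ : ℕ) {p i : ℕ} (hi : 1 ≤ i) {y : ℕ →₀ ℕ}
    (hy : ∀ j, p < j → y j = 0) :
    ∏ j ∈ Finset.range (p + i), rate lam (n₀ + j) ((y + Finsupp.single (p + 1) i) (j + 1)) =
      (∏ j ∈ Finset.range p, rate lam (n₀ + j) (y (j + 1))) * lam (n₀ + p) i := by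
  rw [Finset.prod_range_add]
  congr 1
  · refine Finset.prod_congr rfl fun j hj => ?_
    rw [Finset.mem_range] at hj
    rw [Finsupp.add_apply, Finsupp.single_apply, if_neg (by omega), add_zero]
  · rw [Finset.prod_eq_single_of_mem 0 (Finset.mem_range.2 hi)]
    · rw [add_zero, Finsupp.add_apply, Finsupp.single_eq_same, hy _ (by omega), zero_add, rate,
        if_neg (by omega)]
    · intro j _ hj
      rw [Finsupp.add_apply, Finsupp.single_apply, if_neg (by omega), hy _ (by omega), add_zero,
        rate, if_pos rfl]

/-! ### The enumeration of the visited states -/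

section Enumeration

variable (m : ℕ) (x : ℕ →₀ ℕ)

theorem jIdx_injective : Function.Injective (jIdx m x) :=
  ((Lam m x).orderEmbOfFin rfl).injective

theorem map_jIdx_univ :
    Finset.univ.map ⟨jIdx m x, jIdx_injective m x⟩ = Lam m x :=
  Finset.map_orderEmbOfFin_univ (Lam m x) rfl

theorem sum_jIdx {M : Type*} [AddCommMonoid M] (f : ℕ → M) :
    ∑ l, f (jIdx m x l) = ∑ j ∈ Lam m x, f j := by
  rw [← map_jIdx_univ, Finset.sum_map]
  rfl

theorem prod_jIdx {M : Type*} [CommMonoid M] (f : ℕ → M) :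
    ∏ l, f (jIdx m x l) = ∏ j ∈ Lam m x, f j := by
  rw [← map_jIdx_univ, Finset.prod_map]
  rfl

theorem jIdx_mem (l : Fin (mStar m x)) : jIdx m x l ∈ Lam m x :=
  Finset.orderEmbOfFin_mem _ _ _

theorem exists_jIdx_eq {j : ℕ} (hj : j ∈ Lam m x) : ∃ l, jIdx m x l = j := by
  rw [← map_jIdx_univ, Finset.mem_map] at hj
  obtain ⟨l, _, hl⟩ := hj
  exact ⟨l, hl⟩

theorem jIdx_eq_zero_iff (l : Fin (mStar m x)) : jIdx m x l = 0 ↔ (l : ℕ) = 0 := by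
  have hpos : 0 < mStar m x := Finset.card_pos.2 ⟨0, zero_mem_Lam m x⟩
  have h0 : jIdx m x ⟨0, hpos⟩ = 0 := by
    refine (Finset.orderEmbOfFin_zero rfl hpos).trans ?_
    exact Nat.le_zero.1 (Finset.min'_le _ _ (zero_mem_Lam m x))
  constructor
  · intro h
    have := jIdx_injective m x (h.trans h0.symm)
    rw [this]
  · intro h
    have : l = ⟨0, hpos⟩ := Fin.ext h
    rw [this, h0]

theorem mem_visited_iff {j : ℕ} : j ∈ visited m x ↔ j ≠ 0 ∧ j ∈ Lam m x := Finset.mem_erase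

theorem card_visited : (visited m x).card = mStar m x - 1 :=
  Finset.card_erase_of_mem (zero_mem_Lam m x)

/-- Restriction along `jIdx` identifies the multi-indices on the visited states with `Omega`. -/
theorem sum_Omega (i : ℕ) (F : (Fin (mStar m x) → ℕ) → ℝ) :
    ∑ y ∈ chainIndex (visited m x) i, F (fun l => y (jIdx m x l)) =
      ∑ y ∈ Omega (mStar m x) i, F y := by
  refine Finset.sum_nbij' (fun y l => y (jIdx m x l))
    (fun z => Function.extend (jIdx m x) z 0) ?_ ?_ ?_ ?_ (fun _ _ => rfl)
  · intro y hy
    rw [mem_chainIndex, insert_zero_visited] at hy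
    simp only [Omega, Finset.mem_filter, Finset.mem_piAntidiag]
    refine ⟨⟨?_, fun _ _ => Finset.mem_univ _⟩, fun l hl => hy.2 _ ?_⟩
    · rw [← hy.1.1]
      exact sum_jIdx m x y
    · rw [mem_visited_iff]
      exact ⟨fun h => hl ((jIdx_eq_zero_iff m x l).1 h), jIdx_mem m x l⟩
  · intro z hz
    simp only [Omega, Finset.mem_filter, Finset.mem_piAntidiag] at hz
    rw [mem_chainIndex, insert_zero_visited]
    refine ⟨⟨?_, fun j hj => ?_⟩, fun j hj => ?_⟩
    · rw [← sum_jIdx]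
      simp only [(jIdx_injective m x).extend_apply]
      exact hz.1.1
    · by_contra h
      refine hj (Function.extend_apply' _ _ _ ?_)
      rintro ⟨l, rfl⟩
      exact h (jIdx_mem m x l)
    · rw [mem_visited_iff] at hj
      obtain ⟨l, rfl⟩ := exists_jIdx_eq m x hj.2
      rw [(jIdx_injective m x).extend_apply]
      exact hz.2 l fun h => hj.1 ((jIdx_eq_zero_iff m x l).2 h)
  · intro y hy
    rw [mem_chainIndex, insert_zero_visited] at hy
    funext j
    by_cases hj : j ∈ Lam m x
    · obtain ⟨l, rfl⟩ := exists_jIdx_eq m x hj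
      rw [(jIdx_injective m x).extend_apply]
    · rw [Function.extend_apply']
      · by_contra h
        exact hj (hy.1.2 j (Ne.symm h))
      · rintro ⟨l, rfl⟩
        exact hj (jIdx_mem m x l)
  · intro z _
    funext l
    rw [(jIdx_injective m x).extend_apply]

variable (k n₀ : ℕ) (lam : ℕ → ℕ → ℝ) (α : ℕ → ℝ)

theorem pathTransform_eq (s : ℝ) :
    pathTransform k n₀ lam α m x s =
      s ^ (α (n₀ + 0) - 1) / ∏ j ∈ insert 0 (visited m x),
        (s ^ α (n₀ + j) + ∑ i ∈ Finset.Icc 1 k, lam (n₀ + j) i) := by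
  rw [insert_zero_visited, ← prod_jIdx]
  rfl

theorem pathSeriesTerm_eq (t : ℝ) (i : ℕ) :
    pathSeriesTerm k n₀ lam α m x t i = (-1) ^ i * chainTerm (fun j => α (n₀ + j))
      (fun j => ∑ i ∈ Finset.Icc 1 k, lam (n₀ + j) i) (visited m x) i t := by
  rw [pathSeriesTerm, ← sum_Omega, chainTerm]
  congr 1
  refine Finset.sum_congr rfl fun y _ => ?_
  rw [chainMonomial, insert_zero_visited, ← sum_jIdx, ← prod_jIdx]
  rfl

theorem pathCoeff_eq :
    pathCoeff k n₀ lam m x = (-1) ^ (visited m x).card /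
      ∏ j ∈ visited m x, ∑ i ∈ Finset.Icc 1 k, lam (n₀ + j) i := by
  have h1 : visited m x = (Lam m x).filter fun j => j ≠ 0 := by
    ext j
    rw [mem_visited_iff, Finset.mem_filter, and_comm]
  rw [pathCoeff, card_visited, h1, Finset.prod_filter, Finset.prod_filter, ← prod_jIdx]
  congr 1
  refine Finset.prod_congr rfl fun l _ => ?_
  simp only [ne_eq, jIdx_eq_zero_iff]
  rfl

end Enumeration

/-! ### The system of equations as a system of integral equations -/

/-- The function `∑_x λ_x f_x(t)`, where `x` runs through the paths from `n₀` to `n₀ + m`, `λ_x` is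
the product of the rates of the jumps of `x`, and `f_x` is the chain function of the states that
`x` visits. -/
noncomputable def pathSum (k n₀ : ℕ) (lam : ℕ → ℕ → ℝ) (α : ℕ → ℝ) (m : ℕ) (t : ℝ) : ℝ :=
  ∑ x ∈ pathSet k m, (∏ j ∈ Finset.range m, rate lam (n₀ + j) (x (j + 1))) *
    chainFun (fun j => α (n₀ + j)) (fun j => ∑ i ∈ Finset.Icc 1 k, lam (n₀ + j) i)
      (visited m x) t

section PathSum

variable {k n₀ : ℕ} {lam : ℕ → ℕ → ℝ} {α : ℕ → ℝ}

theorem sum_rates_pos (hk : 1 ≤ k) (hlam : ∀ n ≥ n₀, ∀ i ∈ Finset.Icc 1 k, 0 < lam n i) (j : ℕ) :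
    0 < ∑ i ∈ Finset.Icc 1 k, lam (n₀ + j) i :=
  Finset.sum_pos (hlam (n₀ + j) (Nat.le_add_right _ _)) ⟨1, Finset.mem_Icc.2 ⟨le_rfl, hk⟩⟩

theorem continuousOn_pathSum (hk : 1 ≤ k)
    (hlam : ∀ n ≥ n₀, ∀ i ∈ Finset.Icc 1 k, 0 < lam n i) (hα : ∀ n ≥ n₀, 0 < α n ∧ α n ≤ 1)
    (m : ℕ) : ContinuousOn (pathSum k n₀ lam α m) (Ici 0) := by
  apply continuousOn_finsetSum
  intro x _
  exact continuousOn_const.mul (continuousOn_chainFun (fun j => (hα _ (Nat.le_add_right _ _)).1)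
    (sum_rates_pos hk hlam) (zero_notMem_visited m x))

theorem pathSum_zero (t : ℝ) : pathSum k n₀ lam α 0 t = chainFun (fun j => α (n₀ + j))
    (fun j => ∑ i ∈ Finset.Icc 1 k, lam (n₀ + j) i) ∅ t := by
  simp [pathSum, pathSet_zero, visited_zero]

/-- Conditioning on the last jump: the functions `pathSum` solve the system of integral
equations. -/
theorem pathSum_eq_fracInt (hk : 1 ≤ k)
    (hlam : ∀ n ≥ n₀, ∀ i ∈ Finset.Icc 1 k, 0 < lam n i) (hα : ∀ n ≥ n₀, 0 < α n ∧ α n ≤ 1)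
    {m : ℕ} (hm : 1 ≤ m) {t : ℝ} (ht : 0 ≤ t) :
    pathSum k n₀ lam α m t = fracInt (α (n₀ + m)) (fun s =>
      (∑ i ∈ Finset.Icc 1 (min m k), lam (n₀ + (m - i)) i * pathSum k n₀ lam α (m - i) s)
        - (∑ i ∈ Finset.Icc 1 k, lam (n₀ + m) i) * pathSum k n₀ lam α m s) t := by
  have ha : ∀ j, 0 < α (n₀ + j) := fun j => (hα _ (Nat.le_add_right _ _)).1
  have hμ := sum_rates_pos hk hlam
  set a : ℕ → ℝ := fun j => α (n₀ + j) with hadef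
  set μ : ℕ → ℝ := fun j => ∑ i ∈ Finset.Icc 1 k, lam (n₀ + j) i with hμdef
  -- the contribution of one path, with last jump of size `i` out of the state `m - i`
  have hpath : ∀ i ∈ Finset.Icc 1 (min m k), ∀ y ∈ pathSet k (m - i),
      (∏ j ∈ Finset.range m,
          rate lam (n₀ + j) ((y + Finsupp.single (m - i + 1) i) (j + 1))) =
        (∏ j ∈ Finset.range (m - i), rate lam (n₀ + j) (y (j + 1))) * lam (n₀ + (m - i)) i ∧
      visited m (y + Finsupp.single (m - i + 1) i) = insert m (visited (m - i) y) := by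
    intro i hi y hy
    rw [Finset.mem_Icc] at hi
    have hy0 : ∀ j, m - i < j → y j = 0 := fun j hj => apply_eq_zero_of_mem_pathSet hk hy hj
    have h1 := prod_rate_add_single lam n₀ hi.1 hy0
    have h2 := visited_add_single hi.1 hy0
    rw [show m - i + i = m by omega] at h1 h2
    exact ⟨h1, h2⟩
  have hsum : ∀ s, pathSum k n₀ lam α m s = ∑ i ∈ Finset.Icc 1 (min m k),
      ∑ y ∈ pathSet k (m - i), (∏ j ∈ Finset.range (m - i), rate lam (n₀ + j) (y (j + 1))) *
        lam (n₀ + (m - i)) i * chainFun a μ (insert m (visited (m - i) y)) s := by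
    intro s
    rw [pathSum, sum_pathSet hk hm]
    refine Finset.sum_congr rfl fun i hi => Finset.sum_congr rfl fun y hy => ?_
    rw [(hpath i hi y hy).1, (hpath i hi y hy).2]
  have hdrive : ∀ s, (∑ i ∈ Finset.Icc 1 (min m k),
        lam (n₀ + (m - i)) i * pathSum k n₀ lam α (m - i) s)
        - (∑ i ∈ Finset.Icc 1 k, lam (n₀ + m) i) * pathSum k n₀ lam α m s =
      ∑ i ∈ Finset.Icc 1 (min m k), ∑ y ∈ pathSet k (m - i),
        ((∏ j ∈ Finset.range (m - i), rate lam (n₀ + j) (y (j + 1))) * lam (n₀ + (m - i)) i) *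
          (chainFun a μ (visited (m - i) y) s
            - μ m * chainFun a μ (insert m (visited (m - i) y)) s) := by
    intro s
    rw [hsum, Finset.mul_sum, ← Finset.sum_sub_distrib]
    refine Finset.sum_congr rfl fun i _ => ?_
    rw [pathSum, Finset.mul_sum, Finset.mul_sum, ← Finset.sum_sub_distrib]
    refine Finset.sum_congr rfl fun y _ => ?_
    rw [← hμdef]
    ring
  have hz : ∀ p, p < m → ∀ y, 0 ∉ insert m (visited p y) := fun p hp y h => by
    rcases Finset.mem_insert.1 h with h | h
    · omega
    · exact zero_notMem_visited _ _ h
  have hcont : ∀ i ∈ Finset.Icc 1 (min m k), ∀ y ∈ pathSet k (m - i), ContinuousOn (fun s =>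
      ((∏ j ∈ Finset.range (m - i), rate lam (n₀ + j) (y (j + 1))) * lam (n₀ + (m - i)) i) *
          (chainFun a μ (visited (m - i) y) s
            - μ m * chainFun a μ (insert m (visited (m - i) y)) s)) (Ici 0) := by
    intro i hi y _
    rw [Finset.mem_Icc] at hi
    have h1 := continuousOn_chainFun ha hμ (zero_notMem_visited (m - i) y)
    have h2 := continuousOn_chainFun ha hμ (hz (m - i) (by omega) y)
    exact continuousOn_const.mul (h1.sub (continuousOn_const.mul h2))
  simp only [hdrive]
  rw [fracInt_finset_sum (ha m) ht _ fun i hi => continuousOn_finsetSum _ (hcont i hi), hsum]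
  refine Finset.sum_congr rfl fun i hi => ?_
  rw [fracInt_finset_sum (ha m) ht _ (hcont i hi)]
  refine Finset.sum_congr rfl fun y hy => ?_
  rw [Finset.mem_Icc] at hi
  rw [fracInt_const_mul, ← chainFun_insert ha hμ (hz (m - i) (by omega) y)
    (notMem_visited (by omega) y) ht]

theorem SolvesStateDependentGFBP.continuousOn {q : ℕ → ℝ → ℝ}
    (hq : SolvesStateDependentGFBP k n₀ lam α q) {n : ℕ} (hn : n₀ ≤ n) :
    ContinuousOn (q n) (Ici 0) := by
  intro t ht
  have ht1 : (0 : ℝ) < t + 1 := by linarith [mem_Ici.1 ht]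
  have h := (hq.absCont n hn (t + 1) ht1).continuousOn
  rw [uIcc_of_le ht1.le] at h
  refine (h t ⟨ht, by linarith⟩).mono_of_mem_nhdsWithin ?_
  rw [← Ici_inter_Iic]
  exact inter_mem_nhdsWithin _ (Iic_mem_nhds (by linarith))

/-- The integrated form of the fractional system. -/
theorem SolvesStateDependentGFBP.eq_add_fracInt {q : ℕ → ℝ → ℝ}
    (hq : SolvesStateDependentGFBP k n₀ lam α q) (hα : ∀ n ≥ n₀, 0 < α n ∧ α n ≤ 1) (m : ℕ)
    {t : ℝ} (ht : 0 ≤ t) :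
    q (n₀ + m) t = (if m = 0 then 1 else 0) + fracInt (α (n₀ + m)) (fun s =>
      (∑ i ∈ Finset.Icc 1 (min m k), lam (n₀ + (m - i)) i * q (n₀ + (m - i)) s)
        - (∑ i ∈ Finset.Icc 1 k, lam (n₀ + m) i) * q (n₀ + m) s) t := by
  have hn : n₀ + m ≥ n₀ := Nat.le_add_right _ _
  have h1 := fracInt_caputoDeriv (hα _ hn).1 (hα _ hn).2 ht (hq.absCont _ hn)
  have h2 : q (n₀ + m) 0 = if m = 0 then 1 else 0 := by
    rw [hq.initial _ hn]
    simp only [Nat.add_eq_left]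
  rw [fracInt_congr_ae ht (hq.equation _ hn), h2] at h1
  rw [← sub_eq_iff_eq_add', ← h1]
  apply fracInt_congr ht
  intro s hs
  have h3 : ∑ i ∈ Finset.Icc 1 (min m k), lam (n₀ + (m - i)) i * q (n₀ + (m - i)) s =
      ∑ i ∈ Finset.Icc 1 (min (n₀ + m) k), lam (n₀ + m - i) i * q (n₀ + m - i) s := by
    have hsub : Finset.Icc 1 (min m k) ⊆ Finset.Icc 1 (min (n₀ + m) k) :=
      Finset.Icc_subset_Icc le_rfl (by omega)
    rw [← Finset.sum_subset hsub]
    · refine Finset.sum_congr rfl fun i hi => ?_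
      rw [Finset.mem_Icc] at hi
      rw [show n₀ + m - i = n₀ + (m - i) by omega]
    · -- jumps of size above `m` would start below `n₀`
      intro i hi hi'
      rw [Finset.mem_Icc] at hi hi'
      rw [hq.below (n₀ + m - i) (by omega) s hs, mul_zero]
  rw [h3]
  ring

theorem eq_of_relaxation {a μ c : ℝ} (ha : 0 < a) (hμ : 0 < μ) {u v g h : ℝ → ℝ}
    (hu : ContinuousOn u (Ici 0)) (hv : ContinuousOn v (Ici 0)) (hg : ContinuousOn g (Ici 0))
    (hgh : ∀ s, 0 ≤ s → g s = h s)
    (hu' : ∀ t, 0 ≤ t → u t = c + fracInt a (fun s => g s - μ * u s) t)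
    (hv' : ∀ t, 0 ≤ t → v t = c + fracInt a (fun s => h s - μ * v s) t)
    {t : ℝ} (ht : 0 ≤ t) : u t = v t := by
  rw [← sub_eq_zero]
  refine eq_zero_of_relaxation ha hμ (v := fun t => u t - v t) (hu.sub hv) (fun t ht => ?_) ht
  have h1 : fracInt a (fun s => g s - μ * u s) t =
      fracInt a (fun s => h s - μ * v s) t + fracInt a (fun s => -μ * (u s - v s)) t := by
    have hh : ContinuousOn h (Ici 0) := hg.congr fun s hs => (hgh s hs).symm
    rw [← fracInt_add ha ht (by fun_prop) (by fun_prop)]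
    apply fracInt_congr ht
    intro s hs
    rw [hgh s hs]
    ring
  rw [hu' t ht, hv' t ht, h1, fracInt_const_mul]
  ring

theorem SolvesStateDependentGFBP.eq_pathSum {q : ℕ → ℝ → ℝ}
    (hq : SolvesStateDependentGFBP k n₀ lam α q) (hk : 1 ≤ k)
    (hlam : ∀ n ≥ n₀, ∀ i ∈ Finset.Icc 1 k, 0 < lam n i) (hα : ∀ n ≥ n₀, 0 < α n ∧ α n ≤ 1)
    (m : ℕ) {t : ℝ} (ht : 0 ≤ t) : q (n₀ + m) t = pathSum k n₀ lam α m t := by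
  induction m using Nat.strong_induction_on generalizing t with
  | _ m ih =>
    have ha : ∀ j, 0 < α (n₀ + j) := fun j => (hα _ (Nat.le_add_right _ _)).1
    have hμ := sum_rates_pos hk hlam
    refine eq_of_relaxation (ha m) (hμ m) (hq.continuousOn (Nat.le_add_right _ _))
      (continuousOn_pathSum hk hlam hα m) ?_ ?_ (fun t ht => hq.eq_add_fracInt hα m ht)
      (h := fun s => ∑ i ∈ Finset.Icc 1 (min m k),
        lam (n₀ + (m - i)) i * pathSum k n₀ lam α (m - i) s) ?_ ht
    · exact continuousOn_finsetSum _ fun i _ =>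
        continuousOn_const.mul (hq.continuousOn (Nat.le_add_right _ _))
    · intro s hs
      refine Finset.sum_congr rfl fun i hi => ?_
      rw [Finset.mem_Icc] at hi
      rw [ih (m - i) (by omega) hs]
    · intro t ht
      rcases Nat.eq_zero_or_pos m with rfl | hm
      · have h1 : ∀ s, (∑ i ∈ Finset.Icc 1 (min 0 k),
            lam (n₀ + (0 - i)) i * pathSum k n₀ lam α (0 - i) s)
            - (∑ i ∈ Finset.Icc 1 k, lam (n₀ + 0) i) * pathSum k n₀ lam α 0 s =
            -(∑ i ∈ Finset.Icc 1 k, lam (n₀ + 0) i) * chainFun (fun j => α (n₀ + j))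
              (fun j => ∑ i ∈ Finset.Icc 1 k, lam (n₀ + j) i) ∅ s := fun s => by
          rw [Nat.zero_min, Finset.Icc_eq_empty (by norm_num), Finset.sum_empty, pathSum_zero]
          ring
        simp only [h1]
        rw [pathSum_zero, if_pos trivial, fracInt_const_mul]
        have h2 := chainFun_empty ha hμ ht
        rw [h2]
        ring
      · rw [if_neg (by omega), zero_add]
        exact pathSum_eq_fracInt hk hlam hα hm ht

end PathSum

theorem chainFun_empty_eq_mittagLeffler {a μ : ℕ → ℝ} {t : ℝ} (ht : 0 ≤ t) :
    chainFun a μ ∅ t = mittagLeffler (a 0) (-(μ 0) * t ^ a 0) := by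
  have hidx : ∀ i, chainIndex ∅ i = {Pi.single 0 i} := by
    intro i
    ext y
    rw [mem_chainIndex, Finset.mem_singleton]
    simp only [insert_empty_eq, Finset.sum_singleton, Finset.mem_singleton, Finset.notMem_empty,
      false_implies, implies_true, and_true]
    constructor
    · rintro ⟨h0, h⟩
      funext j
      rcases eq_or_ne j 0 with rfl | hj
      · simp [h0]
      · rw [Pi.single_eq_of_ne hj]
        by_contra h1
        exact hj (h j h1)
    · rintro rfl
      refine ⟨by simp, fun j hj => ?_⟩
      by_contra h1
      exact hj (Pi.single_eq_of_ne h1 _)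
  rw [chainFun, chainSum, mittagLeffler]
  simp only [Finset.card_empty, pow_zero, Finset.prod_empty, div_one, one_mul]
  refine tsum_congr fun i => ?_
  rw [chainTerm, hidx, Finset.sum_singleton, chainMonomial]
  simp only [insert_empty_eq, Finset.sum_singleton, Finset.prod_singleton, Pi.single_eq_same]
  rw [neg_mul, neg_pow (μ 0 * t ^ a 0), mul_pow, mul_comm (i : ℝ), Real.rpow_mul_natCast ht, mul_comm (a 0),
    add_comm 1]
  ring

theorem theorem3p1 (k n₀ : ℕ) (hk : 1 ≤ k) (lam : ℕ → ℕ → ℝ) (α : ℕ → ℝ)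
    (hlam : ∀ n ≥ n₀, ∀ i ∈ Finset.Icc 1 k, 0 < lam n i)
    (hα : ∀ n ≥ n₀, 0 < α n ∧ α n ≤ 1)
    (q : ℕ → ℝ → ℝ) (hq : SolvesStateDependentGFBP k n₀ lam α q) :
    (∀ t : ℝ, 0 ≤ t →
      q n₀ t = mittagLeffler (α n₀) (-(∑ i ∈ Finset.Icc 1 k, lam n₀ i) * t ^ α n₀)) ∧
    ∀ m : ℕ, 1 ≤ m →
      (∀ t : ℝ, 0 ≤ t →
        q (n₀ + m) t =
          if k ≤ m - 1 then
            ∑ x ∈ Theta m k, (∏ j ∈ Finset.range m, rate lam (n₀ + j) (x (j + 1)))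
              * inverseLaplace (pathTransform k n₀ lam α m x) t
          else
            ∑ x ∈ Theta m m, (∏ j ∈ Finset.range m, rate lam (n₀ + j) (x (j + 1)))
              * inverseLaplace (pathTransform k n₀ lam α m x) t) ∧
      ∀ x ∈ (if k ≤ m - 1 then Theta m k else Theta m m),
        IsInverseLaplace (pathTransform k n₀ lam α m x)
          (inverseLaplace (pathTransform k n₀ lam α m x)) ∧
        ∀ t : ℝ, 0 ≤ t →
          -- the series over `i ≥ m^* - 1`, indexed by `r = i - (m^* - 1)`
          Summable (fun r : ℕ => pathSeriesTerm k n₀ lam α m x t (mStar m x - 1 + r)) ∧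
          inverseLaplace (pathTransform k n₀ lam α m x) t =
            pathCoeff k n₀ lam m x *
              ∑' r : ℕ, pathSeriesTerm k n₀ lam α m x t (mStar m x - 1 + r) := by
  have ha : ∀ j, 0 < α (n₀ + j) := fun j => (hα _ (Nat.le_add_right _ _)).1
  have ha1 : ∀ j, α (n₀ + j) ≤ 1 := fun j => (hα _ (Nat.le_add_right _ _)).2
  have hμ := sum_rates_pos hk hlam
  set a : ℕ → ℝ := fun j => α (n₀ + j) with hadef
  set μ : ℕ → ℝ := fun j => ∑ i ∈ Finset.Icc 1 k, lam (n₀ + j) i with hμdef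
  refine ⟨fun t ht => ?_, fun m hm => ?_⟩
  · have h1 := hq.eq_pathSum hk hlam hα 0 ht
    rw [pathSum_zero, chainFun_empty_eq_mittagLeffler ht] at h1
    exact h1
  have hinv : ∀ x, IsInverseLaplace (pathTransform k n₀ lam α m x)
      (chainFun a μ (visited m x)) := by
    intro x
    rw [funext (pathTransform_eq m x k n₀ lam α)]
    exact isInverseLaplace_chainFun ha ha1 hμ (zero_notMem_visited m x)
  have hval : ∀ x t, 0 ≤ t → inverseLaplace (pathTransform k n₀ lam α m x) t =
      chainFun a μ (visited m x) t := fun x t ht =>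
    (isInverseLaplace_inverseLaplace (hinv x)).eq_of_nonneg (hinv x) ht
  refine ⟨fun t ht => ?_, fun x _ => ⟨isInverseLaplace_inverseLaplace (hinv x), fun t ht => ?_⟩⟩
  · have h1 : q (n₀ + m) t = ∑ x ∈ Theta m k,
        (∏ j ∈ Finset.range m, rate lam (n₀ + j) (x (j + 1)))
          * inverseLaplace (pathTransform k n₀ lam α m x) t := by
      rw [hq.eq_pathSum hk hlam hα m ht, pathSum, pathSet_of_pos k hm]
      exact Finset.sum_congr rfl fun x _ => by rw [hval x t ht]
    split_ifs with h
    · exact h1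
    · rw [h1, Theta_eq_of_le (l := m) (by omega) le_rfl]
  · have hsum := summable_chainTerm ha hμ (zero_notMem_visited m x) ht
    have hterm : ∀ r, pathSeriesTerm k n₀ lam α m x t (mStar m x - 1 + r) =
        (-1) ^ (r + (visited m x).card) *
          chainTerm a μ (visited m x) (r + (visited m x).card) t := fun r => by
      rw [pathSeriesTerm_eq, ← card_visited, add_comm r]
    simp only [hterm]
    refine ⟨(summable_nat_add_iff (f := fun i => (-1) ^ i * chainTerm a μ (visited m x) i t)
      (visited m x).card).2 hsum, ?_⟩
    rw [hval x t ht, chainFun, chainSum, pathCoeff_eq, ← hsum.sum_add_tsum_nat_add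
      (visited m x).card, Finset.sum_eq_zero, zero_add]
    intro i hi
    rw [chainTerm_eq_zero_of_lt (Finset.mem_range.1 hi), mul_zero]
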